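/- Let $\sigma\in\{1,-1\}$ be a fixed choice of sign and let $f,h,\mu,\eta$ be real functions on $(0,\infty)$ such that (A1') $f$ is locally Lipschitz and $h'(\rho)=f(\rho)-2/\rho$ for all $\rho>0$; (A2) $h(\rho)\to\infty$ as $\rho\to0^+$ and as $\rho\to\infty$, and $h(\tilde\rho)=0$ for some $\tilde\rho>0$; (A3) $\mu$ and $\eta$ are locally Lipschitz; (A4) $\mu(\rho)>\tfrac12\eta(\rho)>0$ for all $\rho>0$. Consider two unit-speed vehicles in $\mathbb R^3$ with positions $\mathbf r_i$ and right-handed orthonormal frames $(\mathbf x_i,\mathbf y_i,\mathbf z_i)$, $i=1,2$, that satisfy $$\dot{\mathbf r}_i=\mathbf x_i,\quad \dot{\mathbf x}_i=u_i\mathbf y_i+v_i\mathbf z_i,\quad \dot{\mathbf y}_i=-u_i\mathbf x_i,\quad \dot{\mathbf z}_i=-v_i\mathbf x_i,$$ under the circling control law, which with $\mathbf r=\mathbf r_2-\mathbf r_1$ reads $$u_1=F(-\mathbf r,\mathbf x_1,\mathbf y_1,\mathbf x_2)+f(|\mathbf r|)\,\tfrac{\mathbf r}{|\mathbf r|}\cdot\mathbf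 y_1,\qquad v_1=F(-\mathbf r,\mathbf x_1,\mathbf z_1,\mathbf x_2)+f(|\mathbf r|)\,\tfrac{\mathbf r}{|\mathbf r|}\cdot\mathbf z_1,$$ $$u_2=F(\mathbf r,\mathbf x_2,\mathbf y_2,\mathbf x_1)-f(|\mathbf r|)\,\tfrac{\mathbf r}{|\mathbf r|}\cdot\mathbf y_2,\qquad v_2=F(\mathbf r,\mathbf x_2,\mathbf z_2,\mathbf x_1)-f(|\mathbf r|)\,\tfrac{\mathbf r}{|\mathbf r|}\cdot\mathbf z_2,$$ $$F(\mathbf r,\mathbf x,\mathbf y,\mathbf x')=\sigma\,\eta(|\mathbf r|)\Big(\tfrac{\mathbf r}{|\mathbf r|}\cdot\mathbf x\Big)\Big(\tfrac{\mathbf r}{|\mathbf r|}\cdot\mathbf y\Big)+\mu(|\mathbf r|)\Big[-\mathbf x'\cdot\mathbf y+2\Big(\tfrac{\mathbf r}{|\mathbf r|}\cdot\mathbf x'\Big)\Big(\tfrac{\mathbf r}{|\mathbf r|}\cdot\mathbf y\Big)\Big].$$ In $\mathbb R^3\times S^2\times S^2$ let $$\Lambda'=\Big\{(\mathbf r,\mathbf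 x_1,\mathbf x_2)\;\Big|\;1-\mathbf x_2\cdot\mathbf x_1+2\Big(\tfrac{\mathbf r}{|\mathbf r|}\cdot\mathbf x_2\Big)\Big(\tfrac{\mathbf r}{|\mathbf r|}\cdot\mathbf x_1\Big)\ne0,\ |\mathbf r|>0\Big\},\qquad \tilde M'=(M_c\cup M_\ell)\cap\Lambda',$$ $$M_c=\Big\{\mathbf x_1=-\mathbf x_2,\ \mathbf r\cdot\mathbf x_1=0,\ f(|\mathbf r|)=\tfrac{2}{|\mathbf r|}\Big\},\qquad M_\ell=\Big\{\mathbf x_1=\mathbf x_2=\pm\tfrac{\mathbf r}{|\mathbf r|}\Big\}.$$ Then: 1. From every initial state with $(\mathbf r,\mathbf x_1,\mathbf x_2)\in\Lambda'$ there starts a trajectory defined for all $t\ge0$, and every trajectory on an interval $[0,T)$, $0<T<\infty$, that starts at such a state extends to all $t\ge0$. 2. Along every such trajectory on $[0,\infty)$, $(\mathbf r,\mathbf x_1,\mathbf x_2)$ stays in $\Lambda'$ and its distance to $\tilde M'$ tends to $0$ as $t\to\infty$. 3. The elements of $\tilde M'$ correspond to two kinds of formation. A trajectory on $[0,\infty)$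 starts in $M_c\cap\Lambda'$ if and only if for all $t\ge 0$ the two vehicles follow, at unit speed and in diametrically opposite positions, one circle (whose diameter is then $|\mathbf r|$, with $f(|\mathbf r|)=2/|\mathbf r|$). It starts in $M_\ell\cap\Lambda'$ if and only if for all $t\ge 0$ the vehicles move in the same direction, at unit speed, along one straight line, at a constant nonzero separation. -/

import Mathlib

open Filter Topology Set

noncomputable section

namespace TwoVehicle

/-- Physical space `ℝ³` with its Euclidean norm. -/
abbrev E3 : Type := EuclideanSpace ℝ (Fin 3)

/-- The unit sphere `S²`. -/
abbrev S2 : Type := Metric.sphere (0 : E3) 1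

/-- The state of one vehicle: its position and a right-handed orthonormal frame `(x, y, z)`
whose first vector is the heading. -/
structure Vehicle where
  pos : E3
  x : E3
  y : E3
  z : E3
  orthonormal : Orthonormal ℝ ![x, y, z]
  right_handed : Matrix.det (Matrix.of ![x.ofLp, y.ofLp, z.ofLp]) = 1

theorem Vehicle.x_mem_sphere (a : Vehicle) : a.x ∈ Metric.sphere (0 : E3) 1 := by
  have h := a.orthonormal.1 0
  simpa using h

/-- The state of the pair of vehicles. -/
structure Pair where
  v1 : Vehicle
  v2 : Vehicle

/-- The relative position `r = r₂ - r₁`. -/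
def Pair.rel (s : Pair) : E3 := s.v2.pos - s.v1.pos

/-- The space `ℝ³ × S² × S²` of the variables `(r, x₁, x₂)`. -/
abbrev Shape : Type := E3 × S2 × S2

/-- The variables `(r, x₁, x₂)` of a pair of vehicles. -/
def Pair.shape (s : Pair) : Shape :=
  (s.rel, ⟨s.v1.x, s.v1.x_mem_sphere⟩, ⟨s.v2.x, s.v2.x_mem_sphere⟩)

/-- The unit vector `r / |r|`. -/
def unitDir (r : E3) : E3 := ‖r‖⁻¹ • r

/-- The circling interaction term `F(r, x, y, x')`; `σ` is the sign written `±`. -/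
def circF (σ : ℝ) (η μ : ℝ → ℝ) (r x y x' : E3) : ℝ :=
  σ * η ‖r‖ * ((inner ℝ (unitDir r) x) * (inner ℝ (unitDir r) y))
    + μ ‖r‖ * (-(inner ℝ x' y) + 2 * (inner ℝ (unitDir r) x') * (inner ℝ (unitDir r) y))

/-- The feedback along the normal vector `n` of a vehicle with heading `x`, when the other
vehicle has heading `x'` and `r` is the position of this vehicle relative to the other one. -/
def control (σ : ℝ) (η μ f : ℝ → ℝ) (r x n x' : E3) : ℝ :=
  circF σ η μ r x n x' - f ‖r‖ * (inner ℝ (unitDir r) n)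

/-- The natural Frenet equations, over the time interval `J`, of a vehicle with natural
curvatures `u` and `v`. -/
structure FrenetOn (J : Set ℝ) (a : ℝ → Vehicle) (u v : ℝ → ℝ) : Prop where
  pos : ∀ t ∈ J, HasDerivWithinAt (fun τ => (a τ).pos) (a t).x J t
  x : ∀ t ∈ J, HasDerivWithinAt (fun τ => (a τ).x) (u t • (a t).y + v t • (a t).z) J t
  y : ∀ t ∈ J, HasDerivWithinAt (fun τ => (a τ).y) (-(u t • (a t).x)) J t
  z : ∀ t ∈ J, HasDerivWithinAt (fun τ => (a τ).z) (-(v t • (a t).x)) J t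

/-- `s` is, over the time interval `J`, a trajectory of the two vehicles under the circling
control law. -/
def IsTrajectoryOn (σ : ℝ) (η μ f : ℝ → ℝ) (J : Set ℝ) (s : ℝ → Pair) : Prop :=
  FrenetOn J (fun t => (s t).v1)
      (fun t => control σ η μ f (-(s t).rel) (s t).v1.x (s t).v1.y (s t).v2.x)
      (fun t => control σ η μ f (-(s t).rel) (s t).v1.x (s t).v1.z (s t).v2.x) ∧
    FrenetOn J (fun t => (s t).v2)
      (fun t => control σ η μ f (s t).rel (s t).v2.x (s t).v2.y (s t).v1.x)
      (fun t => control σ η μ f (s t).rel (s t).v2.x (s t).v2.z (s t).v1.x)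

/-- The set `Λ'`. -/
def Lam : Set Shape :=
  {p | 1 - (inner ℝ (p.2.2 : E3) (p.2.1 : E3))
          + 2 * (inner ℝ (unitDir p.1) (p.2.2 : E3)) * (inner ℝ (unitDir p.1) (p.2.1 : E3)) ≠ 0 ∧ 0 < ‖p.1‖}

/-- The shapes with opposite headings, orthogonal to the baseline, and `f(|r|) = 2/|r|`. -/
def circlingSet (f : ℝ → ℝ) : Set Shape :=
  {p | (p.2.1 : E3) = -(p.2.2 : E3) ∧ (inner ℝ p.1 (p.2.1 : E3)) = 0 ∧ f ‖p.1‖ = 2 / ‖p.1‖}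

/-- The shapes with both headings equal to `r/|r|`, or both equal to `-r/|r|`. -/
def rectilinearSet : Set Shape :=
  {p | (p.2.1 : E3) = (p.2.2 : E3) ∧
    ((p.2.1 : E3) = unitDir p.1 ∨ (p.2.1 : E3) = -unitDir p.1)}

/-- The limit set `M̃'`. -/
def limitSet (f : ℝ → ℝ) : Set Shape := (circlingSet f ∪ rectilinearSet) ∩ Lam

/-- For `t ≥ 0` the two vehicles move, at unit speed and in diametrically opposite positions,
on one circle, of centre `c` and radius `R`, in the plane through `c` spanned by the orthonormal
vectors `e₁` and `e₂`. -/
def FollowsCommonCircle (s : ℝ → Pair) : Prop :=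
  ∃ (c e₁ e₂ : E3) (R : ℝ), 0 < R ∧ Orthonormal ℝ ![e₁, e₂] ∧ ∀ t, 0 ≤ t →
    (s t).v1.pos = c + R • (Real.cos (t / R) • e₁ + Real.sin (t / R) • e₂) ∧
    (s t).v2.pos = c - R • (Real.cos (t / R) • e₁ + Real.sin (t / R) • e₂)

/-- For `t ≥ 0` the two vehicles move, at unit speed and in the direction `e`, on one straight
line, at the constant nonzero signed separation `d`. -/
def FollowsCommonLine (s : ℝ → Pair) : Prop :=
  ∃ (c e : E3) (d : ℝ), ‖e‖ = 1 ∧ d ≠ 0 ∧ ∀ t, 0 ≤ t →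
    (s t).v1.pos = c + t • e ∧ (s t).v2.pos = c + (t + d) • e

end TwoVehicle

end

open TwoVehicle

/-! Put u = r/|r|, a = u·x₁, b = u·x₂, and let x₁* = x₁ - 2a u be the reflection of x₁ in the plane
orthogonal to r. The function defining Λ' is `gap` = 1 - x₂·x₁*, so it lies in [0, 2] and equals 2
only when x₂ = -x₁*.

The Lyapunov function is V = h(|r|) - log `gap`. In V' the terms with f and 2/|r| cancel, and the
bounds (a+b)² ≤ 2 `gap` and (a-b)² ≤ 2(2 - `gap`) give V' ≤ -(2μ-η)(2 - `gap`) ≤ 0 for either sign σ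
(`lyapRate_le`). Since h blows up at both ends and `gap` ≤ 2, a bound on V confines |r| to a compact
part of (0,∞) and keeps `gap` away from 0 (`exists_bounds_of_lyap_le`). The closed loop is locally
Lipschitz off r = 0, so global existence, uniqueness and invariance of Λ' follow.

For convergence, Barbalat's lemma is used twice in place of an invariance principle
(`tendsto_infDist_limitSet`). V' → 0 forces `gap` → 2, hence b - a → 0. Then (b - a)' → 0 forces
(1-a²)(f - 2/|r|) → 0. What remains is (a²)' = 2ση a²(1-a²) + o(1), which forces a²(1-a²) → 0
(`tendsto_mul_one_sub_zero`). In the limit a = 0 is circling and a² = 1 is rectilinear motion.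

For the formations, explicit circular and straight motions solve the closed loop, and uniqueness
identifies them with the given trajectory. Conversely, differentiating a formation gives the
headings at time 0, and for the circle the radial acceleration determines f. -/

namespace TwoVehicle

/-! ### Global existence and uniqueness for locally Lipschitz equations -/

section ODE

variable {E : Type*} [NormedAddCommGroup E] [NormedSpace ℝ E]

/-- A bounded Lipschitz map into a finite-dimensional space extends to a bounded Lipschitz map. -/
theorem exists_bounded_lipschitz_extension {α : Type*} [PseudoMetricSpace α]
    [FiniteDimensional ℝ E] {s : Set α} {K : NNReal} {f : α → E} (hf : LipschitzOnWith K f s)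
    {M : ℝ} (hM : ∀ x ∈ s, ‖f x‖ ≤ M) :
    ∃ (L C : NNReal) (g : α → E), LipschitzWith L g ∧ (∀ x, ‖g x‖ ≤ C) ∧ EqOn g f s := by
  let A : E ≃L[ℝ] (Module.Basis.ofVectorSpaceIndex ℝ E → ℝ) :=
    (Module.Basis.ofVectorSpace ℝ E).equivFun.toContinuousLinearEquiv
  obtain ⟨G, hG, hGs⟩ := (A.lipschitz.comp_lipschitzOnWith hf).extend_pi
  -- The maximum with 0 keeps `B` nonnegative even when `s` is empty and `M` is negative. Clamping
  -- each extended coordinate to [-B, B] then bounds the extension without changing it on `s`.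
  set B : ℝ := ‖A.toContinuousLinearMap‖ * max M 0 with hB
  have hB0 : 0 ≤ B := by positivity
  let clamp : α → (Module.Basis.ofVectorSpaceIndex ℝ E → ℝ) := fun x i => max (-B) (min B (G x i))
  have hclamp : LipschitzWith (‖A.toContinuousLinearMap‖₊ * K) clamp := by
    refine LipschitzWith.of_dist_le_mul fun x y => (dist_pi_le_iff (by positivity)).2 fun i => ?_
    have hi : LipschitzWith (‖A.toContinuousLinearMap‖₊ * K) fun x => G x i := by
      have h := (LipschitzWith.eval i).comp hG
      rwa [one_mul] at h
    exact ((hi.const_min B).const_max (-B)).dist_le_mul x y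
  have hclampB : ∀ x, ‖clamp x‖ ≤ B := by
    intro x
    rw [pi_norm_le_iff_of_nonneg hB0]
    intro i
    rw [Real.norm_eq_abs, abs_le]
    exact ⟨le_max_left _ _, max_le (by linarith) (min_le_left _ _)⟩
  refine ⟨_, ‖A.symm.toContinuousLinearMap‖₊ * B.toNNReal, fun x => A.symm (clamp x),
    A.symm.lipschitz.comp hclamp, ?_, ?_⟩
  · intro x
    refine (A.symm.toContinuousLinearMap.le_opNorm _).trans ?_
    push_cast
    rw [Real.coe_toNNReal _ hB0]
    gcongr
    exact hclampB x
  · intro x hx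
    have h1 : ‖A (f x)‖ ≤ B :=
      (A.toContinuousLinearMap.le_opNorm _).trans
        (by rw [hB]; gcongr; exact (hM x hx).trans (le_max_left _ _))
    have h2 : clamp x = A (f x) := by
      funext i
      have h3 : |A (f x) i| ≤ B := by
        rw [← Real.norm_eq_abs]; exact (norm_le_pi_norm _ i).trans h1
      have h4 : G x i = A (f x) i := by rw [← hGs hx]; rfl
      rw [abs_le] at h3
      change max (-B) (min B (G x i)) = _
      rw [h4, min_eq_right h3.2, max_eq_right h3.1]
    change A.symm (clamp x) = f x
    rw [h2, A.symm_apply_apply]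

/-- A bounded Lipschitz vector field has global solutions. -/
theorem exists_hasDerivAt_of_bounded_lipschitz [CompleteSpace E] {L C : NNReal} {g : E → E}
    (hg : LipschitzWith L g) (hC : ∀ x, ‖g x‖ ≤ C) (p : E) :
    ∃ y : ℝ → E, y 0 = p ∧ ∀ t, HasDerivAt y (g (y t)) t := by
  have hloc : ∀ n : ℕ, ∃ y : ℝ → E, y 0 = p ∧
      ∀ t ∈ Ioo (-((n : ℝ) + 1)) (n + 1), HasDerivAt y (g (y t)) t := by
    intro n
    have hn : (0 : ℝ) ≤ n := n.cast_nonneg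
    have h0 : (0 : ℝ) ∈ Icc (-((n : ℝ) + 1)) (n + 1) := ⟨by linarith, by linarith⟩
    -- A field bounded by `C` moves a point at most C(n+1) in time n+1, so with this radius the
    -- length of the interval is no restriction.
    have hPL : IsPicardLindelof (fun _ => g) (⟨0, h0⟩ : Icc (-((n : ℝ) + 1)) (n + 1)) p
        (C * (n + 1)) 0 C L :=
      IsPicardLindelof.of_time_independent (fun x _ => hC x) hg.lipschitzOnWith (by simp)
    obtain ⟨y, hy0, hy⟩ := hPL.exists_eq_forall_mem_Icc_hasDerivWithinAt₀
    exact ⟨y, hy0, fun t ht => (hy t (Ioo_subset_Icc_self ht)).hasDerivAt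
      (Icc_mem_nhds ht.1 ht.2)⟩
  choose α hα0 hα using hloc
  have huniq : ∀ m n : ℕ, m ≤ n → EqOn (α m) (α n) (Ioo (-((m : ℝ) + 1)) (m + 1)) := by
    intro m n hmn
    have hmn' : (m : ℝ) ≤ n := by exact_mod_cast hmn
    have hm : (0 : ℝ) ≤ m := m.cast_nonneg
    refine ODE_solution_unique_of_mem_Ioo (v := fun _ => g) (s := fun _ => univ) (K := L) (t₀ := 0)
      (fun _ _ => hg.lipschitzOnWith) ⟨by linarith, by linarith⟩
      (fun t ht => ⟨hα m t ht, mem_univ _⟩)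
      (fun t ht => ⟨hα n t ⟨by linarith [ht.1], by linarith [ht.2]⟩, mem_univ _⟩)
      ((hα0 m).trans (hα0 n).symm)
  have hmem : ∀ t : ℝ, ∀ n : ℕ, |t| ≤ n → t ∈ Ioo (-((n : ℝ) + 1)) (n + 1) := fun t n h => by
    rw [abs_le] at h
    exact ⟨by linarith [h.1], by linarith [h.2]⟩
  -- The solutions are glued by taking the one with index ⌈|t|⌉₊; the extra 1 in the intervals keeps
  -- t in the interior.
  refine ⟨fun t => α ⌈|t|⌉₊ t, by simpa using hα0 0, fun t => ?_⟩
  have hy : ∀ n : ℕ, ∀ s ∈ Ioo (-((n : ℝ) + 1)) (n + 1), α ⌈|s|⌉₊ s = α n s := by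
    intro n s hs
    rcases le_total ⌈|s|⌉₊ n with h | h
    · exact huniq _ _ h (hmem s _ (Nat.le_ceil _))
    · exact (huniq _ _ h hs).symm
  have ht := hmem t _ (Nat.le_ceil |t|)
  refine (hα _ t ht).congr_of_eventuallyEq ?_
  filter_upwards [Ioo_mem_nhds ht.1 ht.2] with s hs
  exact hy _ s hs

/-- A solution of a locally Lipschitz equation exists for all future time if every solution
on a compact time interval stays in a fixed compact subset of the domain. -/
theorem exists_solution_Ici_of_compact [FiniteDimensional ℝ E] {V : E → E}
    {U K : Set E} (hU : IsOpen U) (hV : LocallyLipschitzOn U V) (hK : IsCompact K) (hKU : K ⊆ U)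
    {p : E} (hp : p ∈ K)
    (H : ∀ τ : ℝ, 0 ≤ τ → ∀ y : ℝ → E, y 0 = p →
      (∀ t ∈ Icc 0 τ, HasDerivWithinAt y (V (y t)) (Icc 0 τ) t) → ∀ t ∈ Icc 0 τ, y t ∈ K) :
    ∃ y : ℝ → E, y 0 = p ∧ ∀ t ∈ Ici (0 : ℝ), HasDerivWithinAt y (V (y t)) (Ici 0) t := by
  have : ProperSpace E := FiniteDimensional.proper ℝ E
  have : CompleteSpace E := FiniteDimensional.complete ℝ E
  -- The field is changed only outside `K'`, a compact neighbourhood of `K`. A global solution of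
  -- the changed equation solves the original one as long as it stays in `K'`.
  obtain ⟨K', hK', hKK', hK'U⟩ := exists_compact_between hK hU hKU
  obtain ⟨k, hk⟩ := (hV.mono hK'U).exists_lipschitzOnWith_of_compact hK'
  obtain ⟨M, hM⟩ := hK'.exists_bound_of_continuousOn hk.continuousOn
  obtain ⟨L, C, g, hgL, hgC, hgV⟩ := exists_bounded_lipschitz_extension hk hM
  obtain ⟨y, hy0, hy⟩ := exists_hasDerivAt_of_bounded_lipschitz hgL hgC p
  have hcont : Continuous y := continuous_iff_continuousAt.2 fun t => (hy t).continuousAt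
  have hstay : ∀ τ : ℝ, 0 ≤ τ → (∀ t ∈ Icc 0 τ, y t ∈ K') → ∀ t ∈ Icc 0 τ, y t ∈ K := by
    intro τ hτ h
    refine H τ hτ y hy0 fun t ht => ?_
    rw [← hgV (h t ht)]
    exact (hy t).hasDerivWithinAt
  have hmem : ∀ T : ℝ, 0 ≤ T → y T ∈ K := by
    intro T hT
    set S : Set ℝ := {t | ∀ s ∈ Icc 0 t, y s ∈ K} with hS
    have hclosed : IsClosed (S ∩ Icc 0 T) := by
      rw [← isSeqClosed_iff_isClosed]
      intro u x hu hux
      have hx : x ∈ Icc 0 T := isClosed_Icc.mem_of_tendsto hux (Eventually.of_forall fun n => (hu n).2)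
      refine ⟨fun s hs => ?_, hx⟩
      rcases hs.2.eq_or_lt with rfl | hlt
      · exact hK.isClosed.mem_of_tendsto ((hcont.tendsto _).comp hux)
          (Eventually.of_forall fun n => (hu n).1 _ ⟨(hu n).2.1, le_rfl⟩)
      · obtain ⟨n, hn⟩ := (hux.eventually (lt_mem_nhds hlt)).exists
        exact (hu n).1 s ⟨hs.1, hn.le⟩
    have h0 : (0 : ℝ) ∈ S := by
      intro s hs
      rw [le_antisymm hs.2 hs.1, hy0]; exact hp
    -- If the solution is in `K` up to x, by continuity it is in `K'` a little longer; there it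
    -- solves the original equation, so the a priori bound puts it back in `K`.
    refine hclosed.Icc_subset_of_forall_exists_gt h0 ?_ ⟨hT, le_rfl⟩ T ⟨hT, le_rfl⟩
    rintro x ⟨hxS, hx0, hxT⟩ z hz
    have hnear : ∀ᶠ s in 𝓝 x, y s ∈ K' :=
      hcont.continuousAt.eventually_mem
        (mem_interior_iff_mem_nhds.1 (hKK' (hxS x ⟨hx0, le_rfl⟩)))
    obtain ⟨δ, hδ, hball⟩ := Metric.eventually_nhds_iff.1 hnear
    set w := min z (x + δ / 2)
    have hxw : x < w := lt_min hz (by linarith)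
    refine ⟨w, ?_, hxw, min_le_left _ _⟩
    refine hstay w (hx0.trans hxw.le) fun t ht => ?_
    rcases le_or_gt t x with h | h
    · exact interior_subset (hKK' (hxS t ⟨ht.1, h⟩))
    · refine hball ?_
      rw [Real.dist_eq, abs_of_pos (by linarith)]
      linarith [ht.2.trans (min_le_right z (x + δ / 2))]
  refine ⟨y, hy0, fun t ht => ?_⟩
  rw [← hgV (interior_subset (hKK' (hmem t ht)))]
  exact (hy t).hasDerivWithinAt

/-- Uniqueness of solutions of a locally Lipschitz equation. -/
theorem eqOn_of_locallyLipschitzOn {V : E → E} {U : Set E}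
    (hV : LocallyLipschitzOn U V) {τ : ℝ} {y z : ℝ → E}
    (hy : ∀ t ∈ Icc 0 τ, HasDerivWithinAt y (V (y t)) (Icc 0 τ) t)
    (hz : ∀ t ∈ Icc 0 τ, HasDerivWithinAt z (V (z t)) (Icc 0 τ) t)
    (hyU : ∀ t ∈ Icc 0 τ, y t ∈ U) (hzU : ∀ t ∈ Icc 0 τ, z t ∈ U) (h0 : y 0 = z 0) :
    EqOn y z (Icc 0 τ) := by
  have hyc : ContinuousOn y (Icc 0 τ) := fun t ht => (hy t ht).continuousWithinAt
  have hzc : ContinuousOn z (Icc 0 τ) := fun t ht => (hz t ht).continuousWithinAt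
  have hK : IsCompact (y '' Icc 0 τ ∪ z '' Icc 0 τ) :=
    (isCompact_Icc.image_of_continuousOn hyc).union (isCompact_Icc.image_of_continuousOn hzc)
  obtain ⟨k, hk⟩ := (hV.mono (union_subset (image_subset_iff.2 hyU)
    (image_subset_iff.2 hzU))).exists_lipschitzOnWith_of_compact hK
  have hnhds : ∀ t ∈ Ico 0 τ, Icc 0 τ ∈ 𝓝[Ici t] t := fun t ht =>
    mem_of_superset (Icc_mem_nhdsGE ht.2) (Icc_subset_Icc_left ht.1)
  refine ODE_solution_unique_of_mem_Icc_right (v := fun _ => V)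
    (s := fun _ => y '' Icc 0 τ ∪ z '' Icc 0 τ) (K := k) (fun _ _ => hk) hyc ?_ ?_ hzc ?_ ?_ h0
  · exact fun t ht => (hy t (Ico_subset_Icc_self ht)).mono_of_mem_nhdsWithin (hnhds t ht)
  · exact fun t ht => Or.inl (mem_image_of_mem _ (Ico_subset_Icc_self ht))
  · exact fun t ht => (hz t (Ico_subset_Icc_self ht)).mono_of_mem_nhdsWithin (hnhds t ht)
  · exact fun t ht => Or.inr (mem_image_of_mem _ (Ico_subset_Icc_self ht))

/-- A function with zero derivative on a compact interval is constant there. -/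
theorem eq_of_hasDerivWithinAt_zero {τ : ℝ} {y : ℝ → E}
    (hy : ∀ t ∈ Icc 0 τ, HasDerivWithinAt y 0 (Icc 0 τ) t) :
    ∀ t ∈ Icc 0 τ, y t = y 0 := by
  refine constant_of_has_deriv_right_zero (fun t ht => (hy t ht).continuousWithinAt) fun t ht => ?_
  exact (hy t (Ico_subset_Icc_self ht)).mono_of_mem_nhdsWithin
    (mem_of_superset (Icc_mem_nhdsGE ht.2) (Icc_subset_Icc_left ht.1))

end ODE

/-! ### Limits along trajectories -/

section Asymptotics

/-- Barbalat's lemma. -/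
theorem tendsto_deriv_zero_of_uniformContinuousOn {φ g : ℝ → ℝ} {l : ℝ}
    (hφ : ∀ t, 0 < t → HasDerivAt φ (g t) t) (hl : Tendsto φ atTop (𝓝 l))
    (hg : UniformContinuousOn g (Ici 0)) : Tendsto g atTop (𝓝 0) := by
  rw [Metric.tendsto_atTop]
  intro ε hε
  obtain ⟨δ, hδ, hgδ⟩ := Metric.uniformContinuousOn_iff.1 hg (ε / 2) (by linarith)
  -- Over a time δ/2 the increment of φ is then below εδ/4, so its mean slope is below ε/2; uniform
  -- continuity costs the other ε/2.
  obtain ⟨T, hT⟩ := Metric.tendsto_atTop.1 hl (ε * δ / 8) (by positivity)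
  refine ⟨max T 1, fun t ht => ?_⟩
  have ht1 : 1 ≤ t := (le_max_right _ _).trans ht
  have htT : T ≤ t := (le_max_left _ _).trans ht
  obtain ⟨c, hc, hslope⟩ := exists_hasDerivAt_eq_slope φ g (show t < t + δ / 2 by linarith)
    (fun s hs => (hφ s (by linarith [hs.1])).continuousAt.continuousWithinAt)
    (fun s hs => hφ s (by linarith [hs.1]))
  have h1 := hT t htT
  have h2 := hT (t + δ / 2) (by linarith)
  rw [Real.dist_eq, abs_lt] at h1 h2
  have h3 : |g c| < ε / 2 := by
    rw [hslope, abs_div, div_lt_iff₀ (abs_pos.2 (by linarith)), abs_of_pos (by linarith : 0 < t + δ / 2 - t),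
      abs_lt]
    constructor <;> nlinarith [h1.1, h1.2, h2.1, h2.2]
  have h4 := hgδ t (by simp; linarith) c (by simp; linarith [hc.1])
    (by rw [Real.dist_eq, abs_lt]; constructor <;> linarith [hc.1, hc.2])
  rw [Real.dist_eq] at h4 ⊢
  rw [abs_lt] at *
  constructor <;> linarith [h3.1, h3.2, h4.1, h4.2]

/-- If `G` tends to zero along a curve in a compact set, then so does every continuous function
that vanishes at the zeros of `G`. -/
theorem tendsto_zero_of_zeros_subset {X ι : Type*} [TopologicalSpace X] [T2Space X]
    {l : Filter ι} {K : Set X}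
    (hK : IsCompact K) {p : ι → X} (hp : ∀ᶠ t in l, p t ∈ K) {G H : X → ℝ}
    (hG : ContinuousOn G K) (hH : ContinuousOn H K) (hGH : ∀ x ∈ K, G x = 0 → H x = 0)
    (h : Tendsto (fun t => G (p t)) l (𝓝 0)) : Tendsto (fun t => H (p t)) l (𝓝 0) := by
  rw [Metric.tendsto_nhds]
  intro ε hε
  have hS : IsCompact (K ∩ (fun x => |H x|) ⁻¹' Ici ε) :=
    hK.of_isClosed_subset (hH.abs.preimage_isClosed_of_isClosed hK.isClosed isClosed_Ici)
      inter_subset_left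
  rcases (K ∩ (fun x => |H x|) ⁻¹' Ici ε).eq_empty_or_nonempty with hempty | hne
  · filter_upwards [hp] with t ht
    by_contra hlt
    have : p t ∈ K ∩ (fun x => |H x|) ⁻¹' Ici ε := ⟨ht, by simpa [Real.dist_eq] using hlt⟩
    rw [hempty] at this
    exact this
  · obtain ⟨x₀, hx₀, hmin⟩ := hS.exists_isMinOn hne (hG.abs.mono inter_subset_left)
    have hpos : 0 < |G x₀| := by
      refine abs_pos.2 fun h0 => ?_
      have h1 : ε ≤ |H x₀| := hx₀.2
      rw [hGH x₀ hx₀.1 h0, abs_zero] at h1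
      linarith
    filter_upwards [hp, Metric.tendsto_nhds.1 h _ hpos] with t ht hlt
    rw [Real.dist_eq, sub_zero] at hlt ⊢
    by_contra hge
    exact absurd (hmin (a := p t) ⟨ht, not_lt.1 hge⟩) (not_le.2 hlt)

/-- A function with values in `[0, 1]` that is driven away from `0` and towards `1`, up to a
vanishing error, approaches one of them. -/
theorem tendsto_mul_one_sub_zero {w d e : ℝ → ℝ} {k : ℝ} (hk : 0 < k)
    (hw : ∀ t, 0 < t → w t ∈ Icc (0 : ℝ) 1) (hd : ∀ t, 0 < t → HasDerivAt w (d t) t)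
    (hde : ∀ t, 0 < t → k * (w t * (1 - w t)) + e t ≤ d t) (he : Tendsto e atTop (𝓝 0)) :
    Tendsto (fun t => w t * (1 - w t)) atTop (𝓝 0) := by
  have key : ∀ η : ℝ, 0 < η → η < 1 / 2 → ∀ᶠ t in atTop, w t < η ∨ 1 - η ≤ w t := by
    intro η hη hη2
    -- Half the minimum of k w(1-w) on the band η ≤ w ≤ 1-η; the other half absorbs the error `e`.
    set δ := k * (η * (1 - η)) / 2 with hδ
    have hδ0 : 0 < δ := by
      have : 0 < η * (1 - η) := mul_pos hη (by linarith)
      positivity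
    obtain ⟨T, hT⟩ := Metric.tendsto_atTop.1 he δ hδ0
    have hT' : ∀ t, max T 1 ≤ t → η ≤ w t → w t ≤ 1 - η → δ ≤ d t := by
      intro t ht h1 h2
      have h3 := hT t ((le_max_left _ _).trans ht)
      rw [Real.dist_eq, abs_lt] at h3
      have h4 := hde t (by linarith [(le_max_right T 1).trans ht])
      have h5 : η * (1 - η) ≤ w t * (1 - w t) := by nlinarith
      have h6 := mul_le_mul_of_nonneg_left h5 hk.le
      linarith [h3.1]
    -- In the band the derivative is at least δ, so no level inside it can be crossed downwards.
    have hbar : ∀ c, η ≤ c → c ≤ 1 - η → ∀ t₁, max T 1 ≤ t₁ → c ≤ w t₁ → ∀ t, t₁ ≤ t → c ≤ w t := by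
      intro c hc1 hc2 t₁ ht₁ hw₁ t ht
      have hpos : ∀ s ∈ Icc t₁ t, 0 < s := fun s hs => by
        linarith [(le_max_right T 1).trans (ht₁.trans hs.1)]
      have := image_le_of_deriv_right_lt_deriv_boundary (f := fun s => -w s) (f' := fun s => -d s)
        (a := t₁) (b := t) (B := fun _ => -c) (B' := fun _ => 0)
        (fun s hs => (hd s (hpos s hs)).neg.continuousAt.continuousWithinAt)
        (fun s hs => (hd s (hpos s (Ico_subset_Icc_self hs))).neg.hasDerivWithinAt)
        (by simpa using hw₁) (fun s => hasDerivAt_const _ _)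
        (fun s hs hsc => by
          have hwc : w s = c := by simpa using hsc
          have := hT' s (ht₁.trans hs.1) (by rw [hwc]; exact hc1) (by rw [hwc]; exact hc2)
          linarith) (right_mem_Icc.2 ht)
      simpa using this
    by_cases hsmall : ∀ t, max T 1 ≤ t → w t < η
    · filter_upwards [eventually_ge_atTop (max T 1)] with t ht using Or.inl (hsmall t ht)
    push Not at hsmall
    obtain ⟨t₁, ht₁, hw₁⟩ := hsmall
    have hlow := hbar η le_rfl (by linarith) t₁ ht₁ hw₁
    -- Remaining in the band for a time 2/δ would raise w by at least 2, impossible in [0, 1].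
    have hex : ∃ t₂, t₁ ≤ t₂ ∧ 1 - η ≤ w t₂ := by
      by_contra! hno
      have hgt1 : 1 ≤ t₁ := (le_max_right T 1).trans ht₁
      obtain ⟨c, hc, hslope⟩ := exists_hasDerivAt_eq_slope w d
        (show t₁ < t₁ + 2 / δ by linarith [div_pos two_pos hδ0])
        (fun s hs => (hd s (by linarith [hs.1])).continuousAt.continuousWithinAt)
        (fun s hs => hd s (by linarith [hs.1]))
      have h1 := hT' c (ht₁.trans hc.1.le) (hlow c hc.1.le) (hno c hc.1.le).le
      rw [hslope, add_sub_cancel_left, le_div_iff₀ (by positivity), mul_div_cancel₀ _ hδ0.ne'] at h1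
      have h2 := (hw (t₁ + 2 / δ) (by have := div_pos two_pos hδ0; linarith)).2
      have h3 := (hw t₁ (by linarith)).1
      linarith
    obtain ⟨t₂, ht₂, hw₂⟩ := hex
    filter_upwards [eventually_ge_atTop t₂] with t ht
    exact Or.inr (hbar (1 - η) (by linarith) le_rfl t₂ (ht₁.trans ht₂) hw₂ t ht)
  rw [Metric.tendsto_nhds]
  intro ε hε
  set η := min (ε / 2) (1 / 4) with hηdef
  have hη : 0 < η := lt_min (by linarith) (by norm_num)
  have hη1 : η ≤ ε / 2 := min_le_left _ _
  have hη2 : η ≤ 1 / 4 := min_le_right _ _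
  filter_upwards [key η hη (by linarith), eventually_gt_atTop 0] with t ht ht0
  obtain ⟨h0, h1⟩ := hw t ht0
  rw [Real.dist_eq, sub_zero, abs_of_nonneg (mul_nonneg h0 (by linarith))]
  rcases ht with h | h
  · nlinarith
  · nlinarith

end Asymptotics

/-! ### Steering vector and reflection identities -/

/-- The feedback along a normal `n` is the component along `n` of this steering vector. -/
noncomputable def steer (σ : ℝ) (η μ f : ℝ → ℝ) (r x x' : E3) : E3 :=
  (σ * η ‖r‖ * (inner ℝ (unitDir r) x) + 2 * μ ‖r‖ * (inner ℝ (unitDir r) x') - f ‖r‖) • unitDir r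
    - μ ‖r‖ • x'

/-- Both natural curvatures are components of one vector w. Hence the heading obeys x' = w - (w·x)x,
whichever normals y, z complete the frame. -/
theorem control_eq_inner_steer (σ : ℝ) (η μ f : ℝ → ℝ) (r x n x' : E3) :
    control σ η μ f r x n x' = inner ℝ (steer σ η μ f r x x') n := by
  simp only [control, circF, steer, inner_sub_left, real_inner_smul_left]
  ring

/-- The function whose nonvanishing defines `Λ'`. -/
noncomputable def gap (r x₁ x₂ : E3) : ℝ :=
  1 - (inner ℝ x₂ x₁) + 2 * (inner ℝ (unitDir r) x₂) * (inner ℝ (unitDir r) x₁)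

theorem unitDir_neg (r : E3) : unitDir (-r) = -unitDir r := by
  simp [unitDir]

theorem norm_unitDir {r : E3} (hr : r ≠ 0) : ‖unitDir r‖ = 1 := by
  rw [unitDir, norm_smul, norm_inv, norm_norm, inv_mul_cancel₀ (norm_ne_zero_iff.2 hr)]

theorem inner_unitDir_self {r : E3} (hr : r ≠ 0) : inner ℝ (unitDir r) (unitDir r) = (1 : ℝ) := by
  rw [real_inner_self_eq_norm_sq, norm_unitDir hr, one_pow]

theorem norm_smul_unitDir {r : E3} (hr : r ≠ 0) : ‖r‖ • unitDir r = r := by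
  rw [unitDir, smul_smul, mul_inv_cancel₀ (norm_ne_zero_iff.2 hr), one_smul]

theorem continuousAt_unitDir {r : E3} (hr : r ≠ 0) : ContinuousAt unitDir r :=
  (continuousAt_id.norm.inv₀ (norm_ne_zero_iff.2 hr)).smul continuousAt_id

section Algebra

variable {r x₁ x₂ : E3}

/-- The vector is the difference between x₂ and the mirror image of x₁ in the plane orthogonal to r,
both of unit length. The next identity uses the antipode of that image; together they confine `gap`
to [0, 2]. -/
theorem norm_sq_sub_reflection (hr : r ≠ 0) (h1 : ‖x₁‖ = 1) (h2 : ‖x₂‖ = 1) :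
    ‖x₂ - x₁ + (2 * inner ℝ (unitDir r) x₁) • unitDir r‖ ^ 2 = 2 * gap r x₁ x₂ := by
  have e1 : inner ℝ x₁ x₁ = (1 : ℝ) := by rw [real_inner_self_eq_norm_sq, h1, one_pow]
  have e2 : inner ℝ x₂ x₂ = (1 : ℝ) := by rw [real_inner_self_eq_norm_sq, h2, one_pow]
  have e3 := inner_unitDir_self hr
  rw [← real_inner_self_eq_norm_sq]
  simp only [inner_add_left, inner_add_right, inner_sub_left, inner_sub_right,
    real_inner_smul_left, real_inner_smul_right, gap]
  rw [e1, e2, e3, real_inner_comm x₂ x₁, real_inner_comm (unitDir r) x₁,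
    real_inner_comm (unitDir r) x₂]
  ring

theorem norm_sq_add_reflection (hr : r ≠ 0) (h1 : ‖x₁‖ = 1) (h2 : ‖x₂‖ = 1) :
    ‖x₂ + x₁ - (2 * inner ℝ (unitDir r) x₁) • unitDir r‖ ^ 2 = 2 * (2 - gap r x₁ x₂) := by
  have e1 : inner ℝ x₁ x₁ = (1 : ℝ) := by rw [real_inner_self_eq_norm_sq, h1, one_pow]
  have e2 : inner ℝ x₂ x₂ = (1 : ℝ) := by rw [real_inner_self_eq_norm_sq, h2, one_pow]
  have e3 := inner_unitDir_self hr
  rw [← real_inner_self_eq_norm_sq]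
  simp only [inner_add_left, inner_add_right, inner_sub_left, inner_sub_right,
    real_inner_smul_left, real_inner_smul_right, gap]
  rw [e1, e2, e3, real_inner_comm x₂ x₁, real_inner_comm (unitDir r) x₁,
    real_inner_comm (unitDir r) x₂]
  ring

theorem gap_nonneg (hr : r ≠ 0) (h1 : ‖x₁‖ = 1) (h2 : ‖x₂‖ = 1) : 0 ≤ gap r x₁ x₂ := by
  have := norm_sq_sub_reflection hr h1 h2
  nlinarith [sq_nonneg ‖x₂ - x₁ + (2 * inner ℝ (unitDir r) x₁) • unitDir r‖]

theorem gap_le_two (hr : r ≠ 0) (h1 : ‖x₁‖ = 1) (h2 : ‖x₂‖ = 1) : gap r x₁ x₂ ≤ 2 := by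
  have := norm_sq_add_reflection hr h1 h2
  nlinarith [sq_nonneg ‖x₂ + x₁ - (2 * inner ℝ (unitDir r) x₁) • unitDir r‖]

theorem sq_inner_le_norm_sq {n v : E3} (hn : ‖n‖ = 1) : (inner ℝ n v : ℝ) ^ 2 ≤ ‖v‖ ^ 2 := by
  have := abs_real_inner_le_norm n v
  rw [hn, one_mul] at this
  exact sq_le_sq' (by linarith [(abs_le.1 this).1]) (abs_le.1 this).2

/-- The left side is the squared component along r/|r| of the vector in `norm_sq_sub_reflection`. -/
theorem sq_add_inner_le (hr : r ≠ 0) (h1 : ‖x₁‖ = 1) (h2 : ‖x₂‖ = 1) :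
    ((inner ℝ (unitDir r) x₁ : ℝ) + inner ℝ (unitDir r) x₂) ^ 2 ≤ 2 * gap r x₁ x₂ := by
  rw [← norm_sq_sub_reflection hr h1 h2]
  convert sq_inner_le_norm_sq (norm_unitDir hr) using 2
  simp only [inner_add_right, inner_sub_right, real_inner_smul_right]
  rw [inner_unitDir_self hr]
  ring

/-- The same with the vector of `norm_sq_add_reflection`. -/
theorem sq_sub_inner_le (hr : r ≠ 0) (h1 : ‖x₁‖ = 1) (h2 : ‖x₂‖ = 1) :
    ((inner ℝ (unitDir r) x₂ : ℝ) - inner ℝ (unitDir r) x₁) ^ 2 ≤ 2 * (2 - gap r x₁ x₂) := by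
  rw [← norm_sq_add_reflection hr h1 h2]
  convert sq_inner_le_norm_sq (norm_unitDir hr) using 2
  simp only [inner_add_right, inner_sub_right, real_inner_smul_right]
  rw [inner_unitDir_self hr]
  ring

theorem eq_reflection_of_gap_eq_two (hr : r ≠ 0) (h1 : ‖x₁‖ = 1) (h2 : ‖x₂‖ = 1)
    (hg : gap r x₁ x₂ = 2) : x₂ = (2 * inner ℝ (unitDir r) x₁) • unitDir r - x₁ := by
  have := norm_sq_add_reflection hr h1 h2
  rw [hg, sub_self, mul_zero, sq_eq_zero_iff, norm_eq_zero, sub_eq_zero] at this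
  rw [← this, add_sub_cancel_right]

end Algebra

/-! ### Reduced equations for the relative position and the headings -/

/-- The equations satisfied by the relative position and the headings, over the time
interval `J`. -/
structure IsReducedOn (σ : ℝ) (η μ f : ℝ → ℝ) (J : Set ℝ) (r x₁ x₂ : ℝ → E3) : Prop where
  rel : ∀ t ∈ J, HasDerivWithinAt r (x₂ t - x₁ t) J t
  head₁ : ∀ t ∈ J, HasDerivWithinAt x₁ (steer σ η μ f (-r t) (x₁ t) (x₂ t)
    - (inner ℝ (steer σ η μ f (-r t) (x₁ t) (x₂ t)) (x₁ t) : ℝ) • x₁ t) J t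
  head₂ : ∀ t ∈ J, HasDerivWithinAt x₂ (steer σ η μ f (r t) (x₂ t) (x₁ t)
    - (inner ℝ (steer σ η μ f (r t) (x₂ t) (x₁ t)) (x₂ t) : ℝ) • x₂ t) J t
  norm₁ : ∀ t ∈ J, ‖x₁ t‖ = 1
  norm₂ : ∀ t ∈ J, ‖x₂ t‖ = 1

theorem hasDerivWithinAt_norm {r : ℝ → E3} {r' : E3} {J : Set ℝ} {t : ℝ}
    (h : HasDerivWithinAt r r' J t) (hr : r t ≠ 0) :
    HasDerivWithinAt (fun τ => ‖r τ‖) (inner ℝ (unitDir (r t)) r') J t := by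
  have h1 := h.norm_sq.sqrt (pow_ne_zero 2 (norm_ne_zero_iff.2 hr))
  simp only [Real.sqrt_sq (norm_nonneg _)] at h1
  convert h1 using 1
  have := norm_ne_zero_iff.2 hr
  rw [unitDir, real_inner_smul_left]
  field_simp

theorem hasDerivWithinAt_unitDir {r : ℝ → E3} {r' : E3} {J : Set ℝ} {t : ℝ}
    (h : HasDerivWithinAt r r' J t) (hr : r t ≠ 0) :
    HasDerivWithinAt (fun τ => unitDir (r τ))
      (‖r t‖⁻¹ • (r' - (inner ℝ (unitDir (r t)) r' : ℝ) • unitDir (r t))) J t := by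
  have hn := norm_ne_zero_iff.2 hr
  refine (((hasDerivWithinAt_norm h hr).inv hn).smul h).congr_deriv ?_
  simp only [unitDir, smul_sub, smul_smul]
  rw [sub_eq_add_neg, ← neg_smul]
  congr 2
  field_simp

namespace IsReducedOn

variable {σ : ℝ} {η μ f : ℝ → ℝ} {J : Set ℝ} {r x₁ x₂ : ℝ → E3}

theorem mono {J' : Set ℝ} (h : IsReducedOn σ η μ f J r x₁ x₂) (hJ : J' ⊆ J) :
    IsReducedOn σ η μ f J' r x₁ x₂ where
  rel t ht := (h.rel t (hJ ht)).mono hJ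
  head₁ t ht := (h.head₁ t (hJ ht)).mono hJ
  head₂ t ht := (h.head₂ t (hJ ht)).mono hJ
  norm₁ t ht := h.norm₁ t (hJ ht)
  norm₂ t ht := h.norm₂ t (hJ ht)

/-- The rate of change of `r/|r| · x₁`. -/
noncomputable def rate₁ (σ : ℝ) (η μ f : ℝ → ℝ) (r x₁ x₂ : E3) : ℝ :=
  let a : ℝ := inner ℝ (unitDir r) x₁
  let b : ℝ := inner ℝ (unitDir r) x₂
  let c : ℝ := inner ℝ x₂ x₁
  (c - 1 - (b - a) * a) / ‖r‖ + (σ * η ‖r‖ * a + f ‖r‖) * (1 - a ^ 2)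
    + μ ‖r‖ * (-(b - a * c) + 2 * b * (1 - a ^ 2))

/-- The rate of change of `r/|r| · x₂`. -/
noncomputable def rate₂ (σ : ℝ) (η μ f : ℝ → ℝ) (r x₁ x₂ : E3) : ℝ :=
  let a : ℝ := inner ℝ (unitDir r) x₁
  let b : ℝ := inner ℝ (unitDir r) x₂
  let c : ℝ := inner ℝ x₂ x₁
  (1 - c - (b - a) * b) / ‖r‖ + (σ * η ‖r‖ * b - f ‖r‖) * (1 - b ^ 2)
    + μ ‖r‖ * (-(a - b * c) + 2 * a * (1 - b ^ 2))

variable {t : ℝ}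

theorem hasDerivWithinAt_inner₁ (h : IsReducedOn σ η μ f J r x₁ x₂) (ht : t ∈ J) (hr : r t ≠ 0) :
    HasDerivWithinAt (fun τ => (inner ℝ (unitDir (r τ)) (x₁ τ) : ℝ))
      (rate₁ σ η μ f (r t) (x₁ t) (x₂ t)) J t := by
  refine ((hasDerivWithinAt_unitDir (h.rel t ht) hr).inner ℝ (h.head₁ t ht)).congr_deriv ?_
  have e1 : inner ℝ (x₁ t) (x₁ t) = (1 : ℝ) := by
    rw [real_inner_self_eq_norm_sq, h.norm₁ t ht, one_pow]
  have e3 := inner_unitDir_self hr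
  simp only [rate₁, steer, unitDir_neg, norm_neg, inner_sub_left, inner_sub_right, real_inner_smul_left, real_inner_smul_right, inner_neg_left, inner_neg_right]
  rw [e1, e3]
  field_simp
  ring

theorem hasDerivWithinAt_inner₂ (h : IsReducedOn σ η μ f J r x₁ x₂) (ht : t ∈ J) (hr : r t ≠ 0) :
    HasDerivWithinAt (fun τ => (inner ℝ (unitDir (r τ)) (x₂ τ) : ℝ))
      (rate₂ σ η μ f (r t) (x₁ t) (x₂ t)) J t := by
  refine ((hasDerivWithinAt_unitDir (h.rel t ht) hr).inner ℝ (h.head₂ t ht)).congr_deriv ?_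
  have e1 : inner ℝ (x₂ t) (x₂ t) = (1 : ℝ) := by
    rw [real_inner_self_eq_norm_sq, h.norm₂ t ht, one_pow]
  have e3 := inner_unitDir_self hr
  simp only [rate₂, steer, inner_sub_left,
    inner_sub_right, real_inner_smul_left, real_inner_smul_right]
  rw [e1, e3, real_inner_comm (x₂ t) (x₁ t)]
  field_simp
  ring

theorem hasDerivWithinAt_norm_rel (h : IsReducedOn σ η μ f J r x₁ x₂) (ht : t ∈ J)
    (hr : r t ≠ 0) :
    HasDerivWithinAt (fun τ => ‖r τ‖)
      (inner ℝ (unitDir (r t)) (x₂ t) - inner ℝ (unitDir (r t)) (x₁ t)) J t := by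
  have := hasDerivWithinAt_norm (h.rel t ht) hr
  rwa [inner_sub_right] at this

/-- The terms with f and 2/|r| collect into h'(|r|) · |r|' · `gap`. This is why log `gap` is the
right partner of h: after division by `gap` these terms cancel in the derivative of h(|r|) - log
`gap`. -/
theorem hasDerivWithinAt_gap (h : IsReducedOn σ η μ f J r x₁ x₂) (ht : t ∈ J) (hr : r t ≠ 0) :
    HasDerivWithinAt (fun τ => gap (r τ) (x₁ τ) (x₂ τ))
      ((f ‖r t‖ - 2 / ‖r t‖) *
          ((inner ℝ (unitDir (r t)) (x₂ t) : ℝ) - inner ℝ (unitDir (r t)) (x₁ t)) *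
          gap (r t) (x₁ t) (x₂ t)
        + 2 * μ ‖r t‖ * (gap (r t) (x₁ t) (x₂ t) * (2 - gap (r t) (x₁ t) (x₂ t)))
        + σ * η ‖r t‖ *
          (((inner ℝ (unitDir (r t)) (x₁ t) : ℝ) + inner ℝ (unitDir (r t)) (x₂ t)) ^ 2
            - ((inner ℝ (unitDir (r t)) (x₁ t) : ℝ) ^ 2
              + (inner ℝ (unitDir (r t)) (x₂ t) : ℝ) ^ 2) * gap (r t) (x₁ t) (x₂ t))) J t := by
  have hc := (h.head₂ t ht).inner ℝ (h.head₁ t ht)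
  have ha := h.hasDerivWithinAt_inner₁ ht hr
  have hb := h.hasDerivWithinAt_inner₂ ht hr
  have hn := norm_ne_zero_iff.2 hr
  have e1 : inner ℝ (x₁ t) (x₁ t) = (1 : ℝ) := by
    rw [real_inner_self_eq_norm_sq, h.norm₁ t ht, one_pow]
  have e2 : inner ℝ (x₂ t) (x₂ t) = (1 : ℝ) := by
    rw [real_inner_self_eq_norm_sq, h.norm₂ t ht, one_pow]
  refine ((hc.const_sub 1).add ((hb.const_mul 2).mul ha)).congr_deriv ?_
  simp only [rate₁, rate₂, steer, unitDir_neg, norm_neg, gap, inner_sub_left,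
    inner_sub_right, real_inner_smul_left, real_inner_smul_right, inner_neg_left, inner_neg_right]
  rw [e1, e2, real_inner_comm (unitDir (r t)) (x₂ t), real_inner_comm (x₂ t) (x₁ t)]
  field_simp
  ring

end IsReducedOn

/-! ### Lyapunov function and a priori bounds -/

/-- The rate of change of the Lyapunov function. -/
noncomputable def lyapRate (σ : ℝ) (η μ : ℝ → ℝ) (r x₁ x₂ : E3) : ℝ :=
  -(2 * μ ‖r‖ * (2 - gap r x₁ x₂)) - σ * η ‖r‖ *
    (((inner ℝ (unitDir r) x₁ : ℝ) + inner ℝ (unitDir r) x₂) ^ 2 / gap r x₁ x₂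
      - ((inner ℝ (unitDir r) x₁ : ℝ) ^ 2 + (inner ℝ (unitDir r) x₂ : ℝ) ^ 2))

/-- With q = `gap`, the estimates (a+b)² ≤ 2q and (a-b)² ≤ 2(2-q) bound the bracket multiplying ση
by 2-q in absolute value, so the sign of σ does not matter. -/
theorem lyapRate_le {σ : ℝ} (hσ : σ = 1 ∨ σ = -1) {η μ : ℝ → ℝ} {r x₁ x₂ : E3} (hr : r ≠ 0)
    (h1 : ‖x₁‖ = 1) (h2 : ‖x₂‖ = 1) (hg : 0 < gap r x₁ x₂) (hη : 0 < η ‖r‖) :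
    lyapRate σ η μ r x₁ x₂ ≤ -((2 * μ ‖r‖ - η ‖r‖) * (2 - gap r x₁ x₂)) := by
  have hs := sq_add_inner_le hr h1 h2
  have hd := sq_sub_inner_le hr h1 h2
  have hq2 := gap_le_two hr h1 h2
  unfold lyapRate
  generalize (inner ℝ (unitDir r) x₁ : ℝ) = a at *
  generalize (inner ℝ (unitDir r) x₂ : ℝ) = b at *
  generalize gap r x₁ x₂ = q at *
  have hup : (a + b) ^ 2 / q - (a ^ 2 + b ^ 2) ≤ 2 - q := by
    rw [sub_le_iff_le_add, div_le_iff₀ hg]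
    nlinarith [sq_nonneg (a - b), mul_nonneg (sub_nonneg.2 hq2) (sub_nonneg.2 hs)]
  have hlow : -(2 - q) ≤ (a + b) ^ 2 / q - (a ^ 2 + b ^ 2) := by
    rw [le_sub_iff_add_le, le_div_iff₀ hg]
    nlinarith [sq_nonneg (a + b), mul_nonneg (sub_nonneg.2 hq2) (sq_nonneg (a + b))]
  rcases hσ with rfl | rfl
  · nlinarith [mul_le_mul_of_nonneg_left hlow hη.le]
  · nlinarith [mul_le_mul_of_nonneg_left hup hη.le]

theorem IsReducedOn.hasDerivWithinAt_lyap {σ : ℝ} {η μ f h : ℝ → ℝ} {J : Set ℝ}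
    {r x₁ x₂ : ℝ → E3} (hs : IsReducedOn σ η μ f J r x₁ x₂)
    (hh : ∀ ρ, 0 < ρ → HasDerivAt h (f ρ - 2 / ρ) ρ) {t : ℝ} (ht : t ∈ J) (hr : r t ≠ 0)
    (hg : gap (r t) (x₁ t) (x₂ t) ≠ 0) :
    HasDerivWithinAt (fun τ => h ‖r τ‖ - Real.log (gap (r τ) (x₁ τ) (x₂ τ)))
      (lyapRate σ η μ (r t) (x₁ t) (x₂ t)) J t := by
  refine (((hh _ (norm_pos_iff.2 hr)).comp_hasDerivWithinAt t
    (hs.hasDerivWithinAt_norm_rel ht hr)).sub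
      ((hs.hasDerivWithinAt_gap ht hr).log hg)).congr_deriv ?_
  rw [lyapRate]
  field_simp
  ring

/-- Continuous induction on `[0, τ]`. -/
theorem forall_Icc_of_induction {P : ℝ → Prop} {τ : ℝ} (h0 : P 0)
    (hclosed : ∀ x ∈ Ioc 0 τ, (∀ s ∈ Ico 0 x, P s) → P x)
    (hopen : ∀ x ∈ Ico 0 τ, (∀ s ∈ Icc 0 x, P s) → ∃ w ∈ Ioc x τ, ∀ s ∈ Icc 0 w, P s) :
    ∀ t ∈ Icc 0 τ, P t := by
  intro T hT
  have hcl : IsClosed ({t | ∀ s ∈ Icc 0 t, P s} ∩ Icc 0 τ) := by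
    rw [← isSeqClosed_iff_isClosed]
    intro u x hu hux
    have hx : x ∈ Icc 0 τ := isClosed_Icc.mem_of_tendsto hux (Eventually.of_forall fun n => (hu n).2)
    have hlt : ∀ s ∈ Ico 0 x, P s := fun s hs => by
      obtain ⟨n, hn⟩ := (hux.eventually (lt_mem_nhds hs.2)).exists
      exact (hu n).1 s ⟨hs.1, hn.le⟩
    refine ⟨fun s hs => ?_, hx⟩
    rcases hs.2.eq_or_lt with rfl | h
    · rcases hs.1.eq_or_lt with rfl | h'
      · exact h0
      · exact hclosed _ ⟨h', hx.2⟩ hlt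
    · exact hlt s ⟨hs.1, h⟩
  refine hcl.Icc_subset_of_forall_exists_gt ?_ ?_ hT T ⟨hT.1, le_rfl⟩
  · intro s hs
    rwa [le_antisymm hs.2 hs.1]
  · rintro x ⟨hx, hx0, hxτ⟩ z hz
    obtain ⟨w, hw, hwP⟩ := hopen x ⟨hx0, hxτ⟩ hx
    exact ⟨min w z, fun s hs => hwP s ⟨hs.1, hs.2.trans (min_le_left _ _)⟩,
      lt_min hw.1 hz, min_le_right _ _⟩

section Potential

variable {f h : ℝ → ℝ}

theorem exists_bounds_of_potential_le (h_zero : Tendsto h (𝓝[>] 0) atTop)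
    (h_top : Tendsto h atTop atTop) (c : ℝ) :
    ∃ ρ₀ ρ₁ : ℝ, 0 < ρ₀ ∧ ∀ ρ, 0 < ρ → h ρ ≤ c → ρ₀ ≤ ρ ∧ ρ ≤ ρ₁ := by
  obtain ⟨ρ₁, hρ₁⟩ := eventually_atTop.1 (h_top.eventually_gt_atTop c)
  obtain ⟨ρ₀, hρ₀, hsub⟩ := mem_nhdsGT_iff_exists_Ioo_subset.1 (h_zero.eventually_gt_atTop c)
  refine ⟨ρ₀, ρ₁, hρ₀, fun ρ hρ hle => ⟨?_, ?_⟩⟩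
  · by_contra hlt
    exact absurd (hsub ⟨hρ, not_le.1 hlt⟩) (not_lt.2 hle)
  · by_contra hlt
    exact absurd (hρ₁ ρ (not_le.1 hlt).le) (not_lt.2 hle)

theorem exists_le_potential (hh : ∀ ρ, 0 < ρ → HasDerivAt h (f ρ - 2 / ρ) ρ)
    (h_zero : Tendsto h (𝓝[>] 0) atTop) (h_top : Tendsto h atTop atTop) :
    ∃ m : ℝ, ∀ ρ, 0 < ρ → m ≤ h ρ := by
  obtain ⟨ρ₀, ρ₁, hρ₀, hb⟩ := exists_bounds_of_potential_le h_zero h_top 0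
  have hc : ContinuousOn h (Icc ρ₀ ρ₁) := fun ρ hρ =>
    (hh ρ (hρ₀.trans_le hρ.1)).continuousAt.continuousWithinAt
  obtain ⟨M, hM⟩ := isCompact_Icc.exists_bound_of_continuousOn hc
  refine ⟨min 0 (-M), fun ρ hρ => ?_⟩
  rcases le_total (h ρ) 0 with hle | hle
  · have := hM ρ (hb ρ hρ hle)
    rw [Real.norm_eq_abs] at this
    exact (min_le_right _ _).trans (abs_le.1 this).1
  · exact (min_le_left _ _).trans hle

/-- As log `gap` ≤ log 2, the potential is at most v + log 2, which bounds |r| on both sides. A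
lower bound m of h then gives log `gap` ≥ m - v. -/
theorem exists_bounds_of_lyap_le (hh : ∀ ρ, 0 < ρ → HasDerivAt h (f ρ - 2 / ρ) ρ)
    (h_zero : Tendsto h (𝓝[>] 0) atTop) (h_top : Tendsto h atTop atTop) (v : ℝ) :
    ∃ ρ₀ ρ₁ q₀ : ℝ, 0 < ρ₀ ∧ 0 < q₀ ∧ ∀ r x₁ x₂ : E3, r ≠ 0 → ‖x₁‖ = 1 → ‖x₂‖ = 1 →
      0 < gap r x₁ x₂ → h ‖r‖ - Real.log (gap r x₁ x₂) ≤ v →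
      ρ₀ ≤ ‖r‖ ∧ ‖r‖ ≤ ρ₁ ∧ q₀ ≤ gap r x₁ x₂ := by
  obtain ⟨ρ₀, ρ₁, hρ₀, hb⟩ := exists_bounds_of_potential_le h_zero h_top (v + Real.log 2)
  obtain ⟨m, hm⟩ := exists_le_potential hh h_zero h_top
  refine ⟨ρ₀, ρ₁, Real.exp (m - v), hρ₀, Real.exp_pos _, fun r x₁ x₂ hr h1 h2 hg hv => ?_⟩
  have hn := norm_pos_iff.2 hr
  have hlog := Real.log_le_log hg (gap_le_two hr h1 h2)
  obtain ⟨hl, hu⟩ := hb ‖r‖ hn (by linarith)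
  refine ⟨hl, hu, ?_⟩
  rw [← Real.le_log_iff_exp_le hg]
  linarith [hm ‖r‖ hn]

end Potential

namespace IsReducedOn

variable {σ : ℝ} {η μ f h : ℝ → ℝ} {r x₁ x₂ : ℝ → E3} {τ : ℝ}

theorem antitoneOn_lyap (hs : IsReducedOn σ η μ f (Icc 0 τ) r x₁ x₂) (hσ : σ = 1 ∨ σ = -1)
    (hh : ∀ ρ, 0 < ρ → HasDerivAt h (f ρ - 2 / ρ) ρ)
    (hμη : ∀ ρ, 0 < ρ → η ρ / 2 < μ ρ ∧ 0 < η ρ / 2)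
    (hr : ∀ t ∈ Icc 0 τ, r t ≠ 0) (hg : ∀ t ∈ Icc 0 τ, 0 < gap (r t) (x₁ t) (x₂ t)) :
    AntitoneOn (fun t => h ‖r t‖ - Real.log (gap (r t) (x₁ t) (x₂ t))) (Icc 0 τ) := by
  have hd := fun t ht => hs.hasDerivWithinAt_lyap hh ht (hr t ht) (hg t ht).ne'
  have hd' : ∀ t ∈ Ioo 0 τ, HasDerivAt (fun t => h ‖r t‖ - Real.log (gap (r t) (x₁ t) (x₂ t)))
      (lyapRate σ η μ (r t) (x₁ t) (x₂ t)) t := fun t ht =>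
    (hd t (Ioo_subset_Icc_self ht)).hasDerivAt (Icc_mem_nhds ht.1 ht.2)
  refine antitoneOn_of_deriv_nonpos (convex_Icc _ _) (fun t ht => (hd t ht).continuousWithinAt)
    (fun t ht => ?_) fun t ht => ?_
  · rw [interior_Icc] at ht
    exact (hd' t ht).differentiableAt.differentiableWithinAt
  · rw [interior_Icc] at ht
    rw [(hd' t ht).deriv]
    have ht' := Ioo_subset_Icc_self ht
    have hn := norm_pos_iff.2 (hr t ht')
    obtain ⟨hm1, hm2⟩ := hμη _ hn
    refine (lyapRate_le hσ (hr t ht') (hs.norm₁ t ht') (hs.norm₂ t ht') (hg t ht')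
      (by linarith)).trans ?_
    have := gap_le_two (hr t ht') (hs.norm₁ t ht') (hs.norm₂ t ht')
    rw [neg_nonpos]
    exact mul_nonneg (by linarith) (by linarith)

/-- Monotonicity of V presupposes r ≠ 0 and `gap` > 0, which are themselves to be proved. Continuous
induction breaks the circle: the bounds on a sublevel set depend only on v, so they pass to the
limit at the end of an interval, and continuity carries positivity beyond it. -/
theorem lyap_le (hs : IsReducedOn σ η μ f (Icc 0 τ) r x₁ x₂) (hσ : σ = 1 ∨ σ = -1)
    (hh : ∀ ρ, 0 < ρ → HasDerivAt h (f ρ - 2 / ρ) ρ)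
    (h_zero : Tendsto h (𝓝[>] 0) atTop) (h_top : Tendsto h atTop atTop)
    (hμη : ∀ ρ, 0 < ρ → η ρ / 2 < μ ρ ∧ 0 < η ρ / 2)
    (hr0 : r 0 ≠ 0) (hg0 : 0 < gap (r 0) (x₁ 0) (x₂ 0)) {v : ℝ}
    (hv : h ‖r 0‖ - Real.log (gap (r 0) (x₁ 0) (x₂ 0)) ≤ v) :
    ∀ t ∈ Icc 0 τ, r t ≠ 0 ∧ 0 < gap (r t) (x₁ t) (x₂ t) ∧
      h ‖r t‖ - Real.log (gap (r t) (x₁ t) (x₂ t)) ≤ v := by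
  obtain ⟨ρ₀, ρ₁, q₀, hρ₀, hq₀, hb⟩ := exists_bounds_of_lyap_le hh h_zero h_top v
  have hrc : ∀ t ∈ Icc 0 τ, ContinuousWithinAt r (Icc 0 τ) t := fun t ht =>
    (hs.rel t ht).continuousWithinAt
  have hgc : ∀ t ∈ Icc 0 τ, r t ≠ 0 →
      ContinuousWithinAt (fun s => gap (r s) (x₁ s) (x₂ s)) (Icc 0 τ) t := fun t ht hr =>
    (hs.hasDerivWithinAt_gap ht hr).continuousWithinAt
  refine forall_Icc_of_induction ⟨hr0, hg0, hv⟩ ?_ ?_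
  · intro x hx hP
    have hxI : x ∈ Icc 0 τ := ⟨hx.1.le, hx.2⟩
    have hsub : Ico 0 x ⊆ Icc 0 τ := fun s hs' => ⟨hs'.1, hs'.2.le.trans hx.2⟩
    have hne : (𝓝[Ico 0 x] x).NeBot := by
      rw [← mem_closure_iff_nhdsWithin_neBot, closure_Ico hx.1.ne]
      exact right_mem_Icc.2 hx.1.le
    have hbs : ∀ s ∈ Ico 0 x, ρ₀ ≤ ‖r s‖ ∧ ‖r s‖ ≤ ρ₁ ∧ q₀ ≤ gap (r s) (x₁ s) (x₂ s) := fun s hs' =>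
      hb _ _ _ (hP s hs').1 (hs.norm₁ s (hsub hs')) (hs.norm₂ s (hsub hs')) (hP s hs').2.1
        (hP s hs').2.2
    have h1 : ρ₀ ≤ ‖r x‖ := ge_of_tendsto ((hrc x hxI).mono hsub).norm
      (eventually_nhdsWithin_of_forall fun s hs' => (hbs s hs').1)
    have hrx : r x ≠ 0 := norm_pos_iff.1 (hρ₀.trans_le h1)
    have h2 : q₀ ≤ gap (r x) (x₁ x) (x₂ x) := ge_of_tendsto ((hgc x hxI hrx).mono hsub)
      (eventually_nhdsWithin_of_forall fun s hs' => (hbs s hs').2.2)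
    have hgx : 0 < gap (r x) (x₁ x) (x₂ x) := hq₀.trans_le h2
    refine ⟨hrx, hgx, ?_⟩
    exact le_of_tendsto
      ((hs.hasDerivWithinAt_lyap hh hxI hrx hgx.ne').continuousWithinAt.mono hsub)
      (eventually_nhdsWithin_of_forall fun s hs' => (hP s hs').2.2)
  · intro x hx hP
    have hxI : x ∈ Icc 0 τ := Ico_subset_Icc_self hx
    obtain ⟨hrx, hgx, -⟩ := hP x ⟨hx.1, le_rfl⟩
    have hnear : ∀ᶠ s in 𝓝[Icc 0 τ] x, r s ≠ 0 ∧ 0 < gap (r s) (x₁ s) (x₂ s) :=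
      ((hrc x hxI).eventually_ne hrx).and ((hgc x hxI hrx).eventually (lt_mem_nhds hgx))
    rw [eventually_nhdsWithin_iff, Metric.eventually_nhds_iff] at hnear
    obtain ⟨δ, hδ, hball⟩ := hnear
    have hxw : x < min τ (x + δ / 2) := lt_min hx.2 (by linarith)
    refine ⟨min τ (x + δ / 2), ⟨hxw, min_le_left _ _⟩, ?_⟩
    have hsub : Icc 0 (min τ (x + δ / 2)) ⊆ Icc 0 τ := Icc_subset_Icc_right (min_le_left _ _)
    have hgood : ∀ s ∈ Icc 0 (min τ (x + δ / 2)),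
        r s ≠ 0 ∧ 0 < gap (r s) (x₁ s) (x₂ s) := by
      intro s hs'
      rcases le_or_gt s x with hle | hlt
      · exact ⟨(hP s ⟨hs'.1, hle⟩).1, (hP s ⟨hs'.1, hle⟩).2.1⟩
      · refine hball ?_ (hsub hs')
        rw [Real.dist_eq, abs_of_pos (by linarith)]
        linarith [hs'.2.trans (min_le_right τ (x + δ / 2))]
    intro s hs'
    refine ⟨(hgood s hs').1, (hgood s hs').2, ?_⟩
    exact ((hs.mono hsub).antitoneOn_lyap hσ hh hμη (fun t ht => (hgood t ht).1)
      (fun t ht => (hgood t ht).2) ⟨le_rfl, hx.1.trans hxw.le⟩ hs' hs'.1).trans hv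

end IsReducedOn

/-! ### Preservation of right-handed orthonormal frames -/

section Frames

theorem orthonormal_triple {x y z : E3} (hxx : inner ℝ x x = (1 : ℝ)) (hyy : inner ℝ y y = (1 : ℝ))
    (hzz : inner ℝ z z = (1 : ℝ)) (hxy : inner ℝ x y = (0 : ℝ)) (hxz : inner ℝ x z = (0 : ℝ))
    (hyz : inner ℝ y z = (0 : ℝ)) : Orthonormal ℝ ![x, y, z] := by
  have hn : ∀ v : E3, inner ℝ v v = (1 : ℝ) → ‖v‖ = 1 := fun v hv => by
    rw [norm_eq_sqrt_real_inner, hv, Real.sqrt_one]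
  constructor
  · intro i
    fin_cases i
    · exact hn x hxx
    · exact hn y hyy
    · exact hn z hzz
  · intro i j hij
    fin_cases i <;> fin_cases j <;> first | exact absurd rfl hij | skip
    · exact hxy
    · exact hxz
    · exact (real_inner_comm _ _).trans hxy
    · exact hyz
    · exact (real_inner_comm _ _).trans hxz
    · exact (real_inner_comm _ _).trans hyz

theorem inner_of_orthonormal_triple {x y z : E3} (h : Orthonormal ℝ ![x, y, z]) :
    inner ℝ x x = (1 : ℝ) ∧ inner ℝ y y = (1 : ℝ) ∧ inner ℝ z z = (1 : ℝ) ∧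
      inner ℝ x y = (0 : ℝ) ∧ inner ℝ x z = (0 : ℝ) ∧ inner ℝ y z = (0 : ℝ) := by
  have hn : ∀ v : E3, ‖v‖ = 1 → inner ℝ v v = (1 : ℝ) := fun v hv => by
    rw [real_inner_self_eq_norm_sq, hv, one_pow]
  exact ⟨hn x (h.1 0), hn y (h.1 1), hn z (h.1 2), h.2 (show (0 : Fin 3) ≠ 1 by decide),
    h.2 (show (0 : Fin 3) ≠ 2 by decide), h.2 (show (1 : Fin 3) ≠ 2 by decide)⟩

/-- This removes the normals from the heading equation and closes the system in r, x₁, x₂. -/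
theorem sum_inner_smul_of_orthonormal {x y z : E3} (h : Orthonormal ℝ ![x, y, z]) (w : E3) :
    (inner ℝ w y : ℝ) • y + (inner ℝ w z : ℝ) • z = w - (inner ℝ w x : ℝ) • x := by
  have hspan : ⊤ ≤ Submodule.span ℝ (range ![x, y, z]) :=
    (h.linearIndependent.span_eq_top_of_card_eq_finrank (by simp)).ge
  have := (OrthonormalBasis.mk h hspan).sum_repr' w
  rw [Fin.sum_univ_three] at this
  simp only [OrthonormalBasis.coe_mk, Matrix.cons_val_zero, Matrix.cons_val_one,
    Matrix.cons_val_two, Matrix.head_cons, Matrix.tail_cons] at this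
  rw [eq_sub_iff_add_eq, real_inner_comm y w, real_inner_comm z w, real_inner_comm x w]
  rw [← add_rotate]
  exact this

variable {X Y Z : ℝ → E3} {u v : ℝ → ℝ} {τ : ℝ}

/-- The natural Frenet equations preserve orthonormality. -/
theorem orthonormal_of_frenet
    (hX : ∀ t ∈ Icc 0 τ, HasDerivWithinAt X (u t • Y t + v t • Z t) (Icc 0 τ) t)
    (hY : ∀ t ∈ Icc 0 τ, HasDerivWithinAt Y (-(u t • X t)) (Icc 0 τ) t)
    (hZ : ∀ t ∈ Icc 0 τ, HasDerivWithinAt Z (-(v t • X t)) (Icc 0 τ) t)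
    (h0 : Orthonormal ℝ ![X 0, Y 0, Z 0]) :
    ∀ t ∈ Icc 0 τ, Orthonormal ℝ ![X t, Y t, Z t] := by
  -- The squared Frobenius norm of G - I, with G the Gram matrix of the frame. The Frenet matrix A
  -- is skew, so G' = AG - GA and this norm is constant; no regularity of u and v is needed.
  set S : ℝ → ℝ := fun t => ((inner ℝ (X t) (X t) : ℝ) - 1) ^ 2 + ((inner ℝ (Y t) (Y t) : ℝ) - 1) ^ 2
    + ((inner ℝ (Z t) (Z t) : ℝ) - 1) ^ 2 + 2 * (inner ℝ (X t) (Y t) : ℝ) ^ 2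
    + 2 * (inner ℝ (X t) (Z t) : ℝ) ^ 2 + 2 * (inner ℝ (Y t) (Z t) : ℝ) ^ 2 with hS
  have hS' : ∀ t ∈ Icc 0 τ, HasDerivWithinAt S 0 (Icc 0 τ) t := by
    intro t ht
    have hx := hX t ht
    have hy := hY t ht
    have hz := hZ t ht
    refine (((((((hx.inner ℝ hx).sub_const 1).pow 2).add (((hy.inner ℝ hy).sub_const 1).pow 2)).add
      (((hz.inner ℝ hz).sub_const 1).pow 2)).add (((hx.inner ℝ hy).pow 2).const_mul 2)).add
      (((hx.inner ℝ hz).pow 2).const_mul 2)).add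
      (((hy.inner ℝ hz).pow 2).const_mul 2) |>.congr_deriv ?_
    simp only [inner_add_left, inner_add_right, inner_neg_left, inner_neg_right,
      real_inner_smul_left, real_inner_smul_right]
    rw [real_inner_comm (X t) (Y t), real_inner_comm (X t) (Z t), real_inner_comm (Y t) (Z t)]
    push_cast
    ring
  obtain ⟨h1, h2, h3, h4, h5, h6⟩ := inner_of_orthonormal_triple h0
  intro t ht
  have hSt := eq_of_hasDerivWithinAt_zero hS' t ht
  simp only [hS] at hSt
  rw [h1, h2, h3, h4, h5, h6] at hSt
  have hz : ∀ p : ℝ, p ^ 2 ≤ 0 → p = 0 := fun p hp =>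
    pow_eq_zero_iff two_ne_zero |>.1 (le_antisymm hp (sq_nonneg p))
  have g1 := sq_nonneg ((inner ℝ (X t) (X t) : ℝ) - 1)
  have g2 := sq_nonneg ((inner ℝ (Y t) (Y t) : ℝ) - 1)
  have g3 := sq_nonneg ((inner ℝ (Z t) (Z t) : ℝ) - 1)
  have g4 := sq_nonneg (inner ℝ (X t) (Y t) : ℝ)
  have g5 := sq_nonneg (inner ℝ (X t) (Z t) : ℝ)
  have g6 := sq_nonneg (inner ℝ (Y t) (Z t) : ℝ)
  exact orthonormal_triple (sub_eq_zero.1 (hz _ (by linarith))) (sub_eq_zero.1 (hz _ (by linarith)))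
    (sub_eq_zero.1 (hz _ (by linarith))) (hz _ (by linarith)) (hz _ (by linarith))
    (hz _ (by linarith))

/-- The natural Frenet equations preserve the orientation. -/
theorem det_eq_one_of_frenet
    (hX : ∀ t ∈ Icc 0 τ, HasDerivWithinAt X (u t • Y t + v t • Z t) (Icc 0 τ) t)
    (hY : ∀ t ∈ Icc 0 τ, HasDerivWithinAt Y (-(u t • X t)) (Icc 0 τ) t)
    (hZ : ∀ t ∈ Icc 0 τ, HasDerivWithinAt Z (-(v t • X t)) (Icc 0 τ) t)
    (h0 : Matrix.det (Matrix.of ![(X 0).ofLp, (Y 0).ofLp, (Z 0).ofLp]) = 1) :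
    ∀ t ∈ Icc 0 τ, Matrix.det (Matrix.of ![(X t).ofLp, (Y t).ofLp, (Z t).ofLp]) = 1 := by
  have hdet : ∀ a b c : E3, Matrix.det (Matrix.of ![a.ofLp, b.ofLp, c.ofLp]) =
      a 0 * b 1 * c 2 - a 0 * b 2 * c 1 - a 1 * b 0 * c 2 + a 1 * b 2 * c 0 + a 2 * b 0 * c 1
        - a 2 * b 1 * c 0 := by
    intro a b c
    rw [Matrix.det_fin_three]
    simp
  have hcoord : ∀ {W : ℝ → E3} {W' : E3} {t : ℝ}, HasDerivWithinAt W W' (Icc 0 τ) t →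
      ∀ i, HasDerivWithinAt (fun s => W s i) (W' i) (Icc 0 τ) t := fun h i =>
    (EuclideanSpace.proj (𝕜 := ℝ) i).hasFDerivAt.comp_hasDerivWithinAt _ h
  intro t ht
  rw [← h0]
  -- The Frenet matrix has trace zero, so the determinant has zero derivative.
  refine eq_of_hasDerivWithinAt_zero
    (y := fun t => Matrix.det (Matrix.of ![(X t).ofLp, (Y t).ofLp, (Z t).ofLp])) (fun s hs => ?_) t ht
  simp only [hdet]
  have hx := hcoord (hX s hs)
  have hy := hcoord (hY s hs)
  have hz := hcoord (hZ s hs)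
  refine ((((((((hx 0).mul (hy 1)).mul (hz 2)).sub (((hx 0).mul (hy 2)).mul (hz 1))).sub
    (((hx 1).mul (hy 0)).mul (hz 2))).add (((hx 1).mul (hy 2)).mul (hz 0))).add
    (((hx 2).mul (hy 0)).mul (hz 1))).sub (((hx 2).mul (hy 1)).mul (hz 0))).congr_deriv ?_
  simp only [PiLp.add_apply, PiLp.neg_apply, PiLp.smul_apply, smul_eq_mul, Pi.mul_apply]
  ring

end Frames

/-! ### The closed-loop vector field and its regularity -/

/-- The relative position and the two frames. -/
abbrev State : Type := E3 × (E3 × E3 × E3) × (E3 × E3 × E3)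

/-- The rate of change of a frame under the feedback with steering vector `w`. -/
noncomputable def frameField (w : E3) (F : E3 × E3 × E3) : E3 × E3 × E3 :=
  ((inner ℝ w F.2.1 : ℝ) • F.2.1 + (inner ℝ w F.2.2 : ℝ) • F.2.2,
    -((inner ℝ w F.2.1 : ℝ) • F.1), -((inner ℝ w F.2.2 : ℝ) • F.1))

/-- The closed-loop vector field. -/
noncomputable def field (σ : ℝ) (η μ f : ℝ → ℝ) (s : State) : State :=
  (s.2.2.1 - s.2.1.1, frameField (steer σ η μ f (-s.1) s.2.1.1 s.2.2.1) s.2.1,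
    frameField (steer σ η μ f s.1 s.2.2.1 s.2.1.1) s.2.2)

/-- The frame of a vehicle. -/
def Vehicle.frame (a : Vehicle) : E3 × E3 × E3 := (a.x, a.y, a.z)

/-- The relative position and the frames of a pair. -/
def Pair.state (s : Pair) : State := (s.rel, s.v1.frame, s.v2.frame)

section Regularity

theorem locallyLipschitzOn_comp_norm {g : ℝ → ℝ} (hg : LocallyLipschitzOn (Ioi 0) g) {r : E3}
    (hr : r ≠ 0) : ∃ K, ∃ t ∈ 𝓝 r, LipschitzOnWith K (fun x : E3 => g ‖x‖) t := by
  obtain ⟨K, t, ht, hK⟩ := hg (norm_pos_iff.2 hr)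
  have ht' : t ∈ 𝓝 ‖r‖ := by
    rwa [nhdsWithin_eq_nhds.2 (Ioi_mem_nhds (norm_pos_iff.2 hr))] at ht
  exact ⟨K * 1, _, continuous_norm.continuousAt.preimage_mem_nhds ht',
    hK.comp (lipschitzWith_one_norm.lipschitzOnWith) (mapsTo_preimage _ _)⟩

/-- The steering vector as a function of the gains. -/
noncomputable def steerAux (σ : ℝ) (p : ℝ × ℝ × ℝ) (r x x' : E3) : E3 :=
  (σ * p.1 * (inner ℝ (unitDir r) x) + 2 * p.2.1 * (inner ℝ (unitDir r) x') - p.2.2) • unitDir r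
    - p.2.1 • x'

/-- The closed-loop vector field as a function of the gains. -/
noncomputable def fieldAux (σ : ℝ) (q : (ℝ × ℝ × ℝ) × State) : State :=
  (q.2.2.2.1 - q.2.2.1.1, frameField (steerAux σ q.1 (-q.2.1) q.2.2.1.1 q.2.2.2.1) q.2.2.1,
    frameField (steerAux σ q.1 q.2.1 q.2.2.2.1 q.2.2.1.1) q.2.2.2)

theorem contDiffAt_unitDir {r : E3} (hr : r ≠ 0) : ContDiffAt ℝ 1 unitDir r :=
  ((contDiffAt_norm ℝ hr).inv (norm_ne_zero_iff.2 hr)).smul contDiffAt_id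

section ContDiff

variable {X : Type*} [NormedAddCommGroup X] [NormedSpace ℝ X] {p : X}

theorem contDiffAt_frameField {w x y z : X → E3} (hw : ContDiffAt ℝ 1 w p)
    (hx : ContDiffAt ℝ 1 x p) (hy : ContDiffAt ℝ 1 y p) (hz : ContDiffAt ℝ 1 z p) :
    ContDiffAt ℝ 1 (fun q => frameField (w q) (x q, y q, z q)) p :=
  (((hw.inner ℝ hy).smul hy).add ((hw.inner ℝ hz).smul hz)).prodMk
    ((((hw.inner ℝ hy).smul hx).neg).prodMk (((hw.inner ℝ hz).smul hx).neg))

theorem contDiffAt_steerAux (σ : ℝ) {A B C : X → ℝ} {r x x' : X → E3} (hA : ContDiffAt ℝ 1 A p)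
    (hB : ContDiffAt ℝ 1 B p) (hC : ContDiffAt ℝ 1 C p) (hr : ContDiffAt ℝ 1 r p)
    (hx : ContDiffAt ℝ 1 x p) (hx' : ContDiffAt ℝ 1 x' p) (hr0 : r p ≠ 0) :
    ContDiffAt ℝ 1 (fun q => steerAux σ (A q, B q, C q) (r q) (x q) (x' q)) p := by
  have hu : ContDiffAt ℝ 1 (fun q => unitDir (r q)) p :=
    ContDiffAt.comp (g := unitDir) p (contDiffAt_unitDir hr0) hr
  exact (((((contDiffAt_const (c := σ)).mul hA).mul (hu.inner ℝ hx)).add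
    (((contDiffAt_const (c := (2 : ℝ))).mul hB).mul (hu.inner ℝ hx'))).sub hC).smul hu |>.sub
      (hB.smul hx')

end ContDiff

theorem contDiffAt_fieldAux (σ : ℝ) {q : (ℝ × ℝ × ℝ) × State} (hr : q.2.1 ≠ 0) :
    ContDiffAt ℝ 1 (fieldAux σ) q := by
  have hid : ContDiffAt ℝ 1 (fun q : (ℝ × ℝ × ℝ) × State => q) q := contDiffAt_id
  have hA := hid.fst.fst
  have hB := hid.fst.snd.fst
  have hC := hid.fst.snd.snd
  have hx1 := hid.snd.snd.fst.fst
  have hx2 := hid.snd.snd.snd.fst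
  have h1 := contDiffAt_steerAux σ hA hB hC hid.snd.fst.neg hx1 hx2 (neg_ne_zero.2 hr)
  have h2 := contDiffAt_steerAux σ hA hB hC hid.snd.fst hx2 hx1 hr
  exact (hx2.sub hx1).prodMk ((contDiffAt_frameField h1 hx1 hid.snd.snd.fst.snd.fst
    hid.snd.snd.fst.snd.snd).prodMk (contDiffAt_frameField h2 hx2 hid.snd.snd.snd.snd.fst
    hid.snd.snd.snd.snd.snd))

variable {η μ f : ℝ → ℝ}

/-- The gains are only locally Lipschitz, so the field is factored as the C¹ map `fieldAux`, in
which the gains are independent variables, after the locally Lipschitz map that inserts their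
values. -/
theorem locallyLipschitzOn_field (σ : ℝ) (hη : LocallyLipschitzOn (Ioi 0) η)
    (hμ : LocallyLipschitzOn (Ioi 0) μ) (hf : LocallyLipschitzOn (Ioi 0) f) :
    LocallyLipschitzOn {s : State | s.1 ≠ 0} (field σ η μ f) := by
  intro s hs
  obtain ⟨K₁, t₁, ht₁, h₁⟩ := locallyLipschitzOn_comp_norm hη hs
  obtain ⟨K₂, t₂, ht₂, h₂⟩ := locallyLipschitzOn_comp_norm hμ hs
  obtain ⟨K₃, t₃, ht₃, h₃⟩ := locallyLipschitzOn_comp_norm hf hs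
  let g : State → (ℝ × ℝ × ℝ) × State := fun s => ((η ‖s.1‖, μ ‖s.1‖, f ‖s.1‖), s)
  obtain ⟨K, t, ht, hK⟩ := (contDiffAt_fieldAux σ (q := g s) hs).exists_lipschitzOnWith
  have hfst : ∀ {K' : NNReal} {u : Set E3} {k : E3 → ℝ}, LipschitzOnWith K' k u →
      LipschitzOnWith (K' * 1) (fun s : State => k s.1) (Prod.fst ⁻¹' u) := fun h =>
    h.comp LipschitzWith.prod_fst.lipschitzOnWith (mapsTo_preimage _ _)
  have hmem : ∀ {u : Set E3}, u ∈ 𝓝 s.1 → Prod.fst ⁻¹' u ∈ 𝓝 s := fun h =>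
    continuous_fst.continuousAt.preimage_mem_nhds h
  set T : Set State := Prod.fst ⁻¹' t₁ ∩ Prod.fst ⁻¹' (t₂ ∩ t₃)
  have g₁ := (hfst h₁).mono (show T ⊆ Prod.fst ⁻¹' t₁ from fun x hx => hx.1)
  have g₂ := (hfst h₂).mono (show T ⊆ Prod.fst ⁻¹' t₂ from fun x hx => hx.2.1)
  have g₃ := (hfst h₃).mono (show T ⊆ Prod.fst ⁻¹' t₃ from fun x hx => hx.2.2)
  have hgL : LipschitzOnWith _ g T :=
    (g₁.prodMk (g₂.prodMk g₃)).prodMk (LipschitzWith.id (α := State)).lipschitzOnWith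
  have hT : T ∈ 𝓝 s :=
    inter_mem (hmem ht₁) (hmem (inter_mem ht₂ ht₃))
  have hgc : ContinuousAt g s := hgL.continuousOn.continuousAt hT
  have hfg : field σ η μ f = fieldAux σ ∘ g := by
    funext s
    simp only [field, fieldAux, steer, steerAux, g, Function.comp_apply, norm_neg]
  have hcomp := hK.comp (hgL.mono (inter_subset_left (t := g ⁻¹' t))) fun x hx => hx.2
  rw [hfg]
  exact ⟨_, _, mem_nhdsWithin_of_mem_nhds (inter_mem hT (hgc.preimage_mem_nhds ht)), hcomp⟩

end Regularity

section Components

variable {E F : Type*} [NormedAddCommGroup E] [NormedSpace ℝ E] [NormedAddCommGroup F]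
  [NormedSpace ℝ F]

theorem hasDerivWithinAt_fst {y : ℝ → E × F} {y' : E × F} {J : Set ℝ} {t : ℝ}
    (h : HasDerivWithinAt y y' J t) : HasDerivWithinAt (fun τ => (y τ).1) y'.1 J t :=
  (ContinuousLinearMap.fst ℝ E F).hasFDerivAt.comp_hasDerivWithinAt t h

theorem hasDerivWithinAt_snd {y : ℝ → E × F} {y' : E × F} {J : Set ℝ} {t : ℝ}
    (h : HasDerivWithinAt y y' J t) : HasDerivWithinAt (fun τ => (y τ).2) y'.2 J t :=
  (ContinuousLinearMap.snd ℝ E F).hasFDerivAt.comp_hasDerivWithinAt t h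

end Components

/-! ### Trajectories and solutions of the closed loop -/

section Trajectories

variable {σ : ℝ} {η μ f : ℝ → ℝ} {J : Set ℝ}

/-- The relative position and frames obey an autonomous equation of their own; the absolute
positions then follow by quadrature. -/
theorem isTrajectoryOn_iff {s : ℝ → Pair} : IsTrajectoryOn σ η μ f J s ↔
    (∀ t ∈ J, HasDerivWithinAt (fun τ => (s τ).v1.pos) (s t).v1.x J t) ∧
    (∀ t ∈ J, HasDerivWithinAt (fun τ => (s τ).v2.pos) (s t).v2.x J t) ∧
    ∀ t ∈ J, HasDerivWithinAt (fun τ => (s τ).state) (field σ η μ f (s t).state) J t := by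
  constructor
  · rintro ⟨h1, h2⟩
    refine ⟨h1.pos, h2.pos, fun t ht => ?_⟩
    have hx1 := h1.x t ht
    have hy1 := h1.y t ht
    have hz1 := h1.z t ht
    have hx2 := h2.x t ht
    have hy2 := h2.y t ht
    have hz2 := h2.z t ht
    simp only [control_eq_inner_steer] at hx1 hy1 hz1 hx2 hy2 hz2
    exact ((h2.pos t ht).sub (h1.pos t ht)).prodMk ((hx1.prodMk (hy1.prodMk hz1)).prodMk
      (hx2.prodMk (hy2.prodMk hz2)))
  · rintro ⟨hp1, hp2, h⟩
    have hF1 := fun t ht => hasDerivWithinAt_fst (hasDerivWithinAt_snd (h t ht))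
    have hF2 := fun t ht => hasDerivWithinAt_snd (hasDerivWithinAt_snd (h t ht))
    refine ⟨⟨hp1, fun t ht => ?_, fun t ht => ?_, fun t ht => ?_⟩,
      ⟨hp2, fun t ht => ?_, fun t ht => ?_, fun t ht => ?_⟩⟩
    all_goals simp only [control_eq_inner_steer]
    · exact hasDerivWithinAt_fst (hF1 t ht)
    · exact hasDerivWithinAt_fst (hasDerivWithinAt_snd (hF1 t ht))
    · exact hasDerivWithinAt_snd (hasDerivWithinAt_snd (hF1 t ht))
    · exact hasDerivWithinAt_fst (hF2 t ht)
    · exact hasDerivWithinAt_fst (hasDerivWithinAt_snd (hF2 t ht))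
    · exact hasDerivWithinAt_snd (hasDerivWithinAt_snd (hF2 t ht))

theorem IsTrajectoryOn.mono {J' : Set ℝ} {s : ℝ → Pair} (h : IsTrajectoryOn σ η μ f J s)
    (hJ : J' ⊆ J) : IsTrajectoryOn σ η μ f J' s := by
  rw [isTrajectoryOn_iff] at h ⊢
  exact ⟨fun t ht => (h.1 t (hJ ht)).mono hJ, fun t ht => (h.2.1 t (hJ ht)).mono hJ,
    fun t ht => (h.2.2 t (hJ ht)).mono hJ⟩

theorem isReducedOn_of_field {y : ℝ → State}
    (h : ∀ t ∈ J, HasDerivWithinAt y (field σ η μ f (y t)) J t)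
    (ho1 : ∀ t ∈ J, Orthonormal ℝ ![(y t).2.1.1, (y t).2.1.2.1, (y t).2.1.2.2])
    (ho2 : ∀ t ∈ J, Orthonormal ℝ ![(y t).2.2.1, (y t).2.2.2.1, (y t).2.2.2.2]) :
    IsReducedOn σ η μ f J (fun t => (y t).1) (fun t => (y t).2.1.1) (fun t => (y t).2.2.1) where
  rel t ht := hasDerivWithinAt_fst (h t ht)
  head₁ t ht := by
    rw [← sum_inner_smul_of_orthonormal (ho1 t ht)]
    exact hasDerivWithinAt_fst (hasDerivWithinAt_fst (hasDerivWithinAt_snd (h t ht)))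
  head₂ t ht := by
    rw [← sum_inner_smul_of_orthonormal (ho2 t ht)]
    exact hasDerivWithinAt_fst (hasDerivWithinAt_snd (hasDerivWithinAt_snd (h t ht)))
  norm₁ t ht := (ho1 t ht).1 0
  norm₂ t ht := (ho2 t ht).1 0

theorem IsTrajectoryOn.isReducedOn {s : ℝ → Pair} (h : IsTrajectoryOn σ η μ f J s) :
    IsReducedOn σ η μ f J (fun t => (s t).rel) (fun t => (s t).v1.x) (fun t => (s t).v2.x) :=
  isReducedOn_of_field (isTrajectoryOn_iff.1 h).2.2 (fun t _ => (s t).v1.orthonormal)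
    (fun t _ => (s t).v2.orthonormal)

/-- Since `gap` is never negative off r = 0, nonvanishing is positivity, and its logarithm can be
used. -/
theorem mem_Lam_iff {s : Pair} :
    s.shape ∈ Lam ↔ s.rel ≠ 0 ∧ 0 < gap s.rel s.v1.x s.v2.x := by
  have h : s.shape ∈ Lam ↔ gap s.rel s.v1.x s.v2.x ≠ 0 ∧ 0 < ‖s.rel‖ := Iff.rfl
  rw [h, norm_pos_iff, and_comm]
  refine and_congr_right fun hr => ⟨fun hne => ?_, ne_of_gt⟩
  exact lt_of_le_of_ne (gap_nonneg hr (s.v1.orthonormal.1 0) (s.v2.orthonormal.1 0)) hne.symm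

theorem frames_of_field {τ : ℝ} {y : ℝ → State} {s₀ : Pair} (hy0 : y 0 = s₀.state)
    (h : ∀ t ∈ Icc 0 τ, HasDerivWithinAt y (field σ η μ f (y t)) (Icc 0 τ) t) :
    ∀ t ∈ Icc 0 τ,
      (Orthonormal ℝ ![(y t).2.1.1, (y t).2.1.2.1, (y t).2.1.2.2] ∧
        Matrix.det (Matrix.of ![(y t).2.1.1.ofLp, (y t).2.1.2.1.ofLp, (y t).2.1.2.2.ofLp]) = 1) ∧
      (Orthonormal ℝ ![(y t).2.2.1, (y t).2.2.2.1, (y t).2.2.2.2] ∧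
        Matrix.det (Matrix.of ![(y t).2.2.1.ofLp, (y t).2.2.2.1.ofLp, (y t).2.2.2.2.ofLp]) = 1) := by
  have hF1 := fun t ht => hasDerivWithinAt_fst (hasDerivWithinAt_snd (h t ht))
  have hF2 := fun t ht => hasDerivWithinAt_snd (hasDerivWithinAt_snd (h t ht))
  have hx1 := fun t ht => hasDerivWithinAt_fst (hF1 t ht)
  have hy1 := fun t ht => hasDerivWithinAt_fst (hasDerivWithinAt_snd (hF1 t ht))
  have hz1 := fun t ht => hasDerivWithinAt_snd (hasDerivWithinAt_snd (hF1 t ht))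
  have hx2 := fun t ht => hasDerivWithinAt_fst (hF2 t ht)
  have hy2 := fun t ht => hasDerivWithinAt_fst (hasDerivWithinAt_snd (hF2 t ht))
  have hz2 := fun t ht => hasDerivWithinAt_snd (hasDerivWithinAt_snd (hF2 t ht))
  intro t ht
  refine ⟨⟨orthonormal_of_frenet hx1 hy1 hz1 ?_ t ht, det_eq_one_of_frenet hx1 hy1 hz1 ?_ t ht⟩,
    orthonormal_of_frenet hx2 hy2 hz2 ?_ t ht, det_eq_one_of_frenet hx2 hy2 hz2 ?_ t ht⟩
  all_goals rw [hy0]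
  · exact s₀.v1.orthonormal
  · exact s₀.v1.right_handed
  · exact s₀.v2.orthonormal
  · exact s₀.v2.right_handed

/-- A solution of the closed-loop equations that starts at the state of a pair is the state of a
trajectory. -/
theorem exists_trajectory_of_field {y : ℝ → State} {s₀ : Pair} (hy0 : y 0 = s₀.state)
    (h : ∀ t ∈ Ici (0 : ℝ), HasDerivWithinAt y (field σ η μ f (y t)) (Ici 0) t) :
    ∃ s : ℝ → Pair, IsTrajectoryOn σ η μ f (Ici 0) s ∧ s 0 = s₀ := by
  have hfr : ∀ t : ℝ, 0 ≤ t → _ := fun t ht => frames_of_field (τ := t) hy0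
    (fun s hs => (h s hs.1).mono Icc_subset_Ici_self) t ⟨ht, le_rfl⟩
  -- A `Pair` must carry valid frames at every real time, but they are known only for t ≥ 0; the
  -- motion is therefore frozen before time 0.
  have hm : ∀ t : ℝ, 0 ≤ max t 0 := fun t => le_max_right _ _
  have hc : Continuous fun t : ℝ => (y (max t 0)).2.1.1 := by
    have hyc : ContinuousOn y (Ici 0) := fun t ht => (h t ht).continuousWithinAt
    have : Continuous fun t : ℝ => y (max t 0) :=
      hyc.comp_continuous (by fun_prop) fun t => hm t
    exact this.snd.fst.fst
  let P : ℝ → E3 := fun t => s₀.v1.pos + ∫ τ in (0 : ℝ)..t, (y (max τ 0)).2.1.1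
  have hP : ∀ t, HasDerivAt P (y (max t 0)).2.1.1 t := fun t =>
    ((hc.integral_hasStrictDerivAt 0 t).hasDerivAt).const_add _
  have hP0 : P 0 = s₀.v1.pos := by simp [P]
  let s : ℝ → Pair := fun t =>
    { v1 := ⟨P (max t 0), _, _, _, (hfr _ (hm t)).1.1, (hfr _ (hm t)).1.2⟩
      v2 := ⟨P (max t 0) + (y (max t 0)).1, _, _, _, (hfr _ (hm t)).2.1, (hfr _ (hm t)).2.2⟩ }
  have hst : ∀ t, (s t).state = y (max t 0) := fun t => by
    simp [s, Pair.state, Pair.rel, Vehicle.frame]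
  have hEq : EqOn (fun t => (s t).state) y (Ici 0) := fun t ht => by
    change (s t).state = y t
    rw [hst, max_eq_left ht]
  have hP' : ∀ t ∈ Ici (0 : ℝ), HasDerivWithinAt (fun τ => P (max τ 0)) (y (max t 0)).2.1.1
      (Ici 0) t := fun t ht => (hP t).hasDerivWithinAt.congr
    (fun τ hτ => by rw [max_eq_left hτ]) (by rw [max_eq_left ht])
  refine ⟨s, isTrajectoryOn_iff.2 ⟨hP', fun t ht => ?_, fun t ht => ?_⟩, ?_⟩
  · have h1 : HasDerivWithinAt (fun τ => (y (max τ 0)).1) (field σ η μ f (y (max t 0))).1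
        (Ici 0) t := by
      have := hasDerivWithinAt_fst (h t ht)
      rw [max_eq_left ht]
      exact this.congr (fun τ hτ => by rw [max_eq_left hτ]) (by rw [max_eq_left ht])
    refine ((hP' t ht).add h1).congr_deriv ?_
    simp [field, s]
  · rw [hst, max_eq_left ht]
    exact (h t ht).congr hEq (hEq ht)
  · have h0 : y (max 0 0) = s₀.state := by rw [max_self, hy0]
    have hP0' : P (max 0 0) = s₀.v1.pos := by rw [max_self, hP0]
    obtain ⟨⟨p1, x1, y1, z1, o1, d1⟩, ⟨p2, x2, y2, z2, o2, d2⟩⟩ := s₀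
    simp only [s, h0, hP0', Pair.state, Pair.rel, Vehicle.frame]
    simp

end Trajectories

/-! ### Global existence, uniqueness and invariance -/

/-- The standing assumptions on the gains. -/
structure GainConditions (σ : ℝ) (f h μ η : ℝ → ℝ) : Prop where
  sign : σ = 1 ∨ σ = -1
  potential : ∀ ρ, 0 < ρ → HasDerivAt h (f ρ - 2 / ρ) ρ
  lip_f : LocallyLipschitzOn (Ioi 0) f
  potential_zero : Tendsto h (𝓝[>] 0) atTop
  potential_top : Tendsto h atTop atTop
  lip_μ : LocallyLipschitzOn (Ioi 0) μ
  lip_η : LocallyLipschitzOn (Ioi 0) η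
  gains : ∀ ρ, 0 < ρ → η ρ / 2 < μ ρ ∧ 0 < η ρ / 2

variable {σ : ℝ} {f h μ η : ℝ → ℝ}

section Global

theorem IsTrajectoryOn.mem_Lam (H : GainConditions σ f h μ η) {τ : ℝ} {s : ℝ → Pair}
    (hs : IsTrajectoryOn σ η μ f (Icc 0 τ) s) (h0 : (s 0).shape ∈ Lam) :
    ∀ t ∈ Icc 0 τ, (s t).shape ∈ Lam := fun t ht => by
  obtain ⟨hr, hg⟩ := mem_Lam_iff.1 h0
  have := hs.isReducedOn.lyap_le H.sign H.potential H.potential_zero H.potential_top H.gains hr hg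
    le_rfl t ht
  exact mem_Lam_iff.2 ⟨this.1, this.2.1⟩

/-- The compact set is cut out by the bounds on |r| from the initial value of V; the maximum with 1
makes room for the unit frame vectors in the sup norm of `State`. -/
theorem exists_trajectory (H : GainConditions σ f h μ η) {s₀ : Pair} (h0 : s₀.shape ∈ Lam) :
    ∃ s : ℝ → Pair, IsTrajectoryOn σ η μ f (Ici 0) s ∧ s 0 = s₀ := by
  obtain ⟨hr, hg⟩ := mem_Lam_iff.1 h0
  obtain ⟨ρ₀, ρ₁, q₀, hρ₀, -, hb⟩ := exists_bounds_of_lyap_le H.potential H.potential_zero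
    H.potential_top (h ‖s₀.rel‖ - Real.log (gap s₀.rel s₀.v1.x s₀.v2.x))
  have hcl : IsClosed {s : State | ρ₀ ≤ ‖s.1‖} := isClosed_le continuous_const (by fun_prop)
  have hmem : ∀ s : State, ρ₀ ≤ ‖s.1‖ → ‖s.1‖ ≤ ρ₁ →
      Orthonormal ℝ ![s.2.1.1, s.2.1.2.1, s.2.1.2.2] →
      Orthonormal ℝ ![s.2.2.1, s.2.2.2.1, s.2.2.2.2] →
      s ∈ {s : State | ρ₀ ≤ ‖s.1‖} ∩ Metric.closedBall 0 (max ρ₁ 1) := by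
    intro s h1 h2 ho1 ho2
    refine ⟨h1, ?_⟩
    have h11 : ‖s.2.1.1‖ = 1 := ho1.1 0
    have h12 : ‖s.2.1.2.1‖ = 1 := ho1.1 1
    have h13 : ‖s.2.1.2.2‖ = 1 := ho1.1 2
    have h21 : ‖s.2.2.1‖ = 1 := ho2.1 0
    have h22 : ‖s.2.2.2.1‖ = 1 := ho2.1 1
    have h23 : ‖s.2.2.2.2‖ = 1 := ho2.1 2
    simp only [mem_closedBall_zero_iff, Prod.norm_def, h11, h12, h13, h21, h22, h23, max_self]
    exact max_le_max_right _ h2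
  obtain ⟨y, hy0, hy⟩ := exists_solution_Ici_of_compact
    (U := {s : State | s.1 ≠ 0})
    (K := {s : State | ρ₀ ≤ ‖s.1‖} ∩ Metric.closedBall 0 (max ρ₁ 1)) (p := s₀.state)
    (isOpen_ne_fun continuous_fst continuous_const)
    (locallyLipschitzOn_field σ H.lip_η H.lip_μ H.lip_f)
    ((isCompact_closedBall _ _).inter_left hcl)
    (fun s hs => norm_pos_iff.1 (hρ₀.trans_le hs.1))
    (hmem _ (hb _ _ _ hr (s₀.v1.orthonormal.1 0) (s₀.v2.orthonormal.1 0) hg le_rfl).1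
      (hb _ _ _ hr (s₀.v1.orthonormal.1 0) (s₀.v2.orthonormal.1 0) hg le_rfl).2.1
      s₀.v1.orthonormal s₀.v2.orthonormal)
    (fun τ _ y hy0 hy t ht => by
      have hfr := frames_of_field hy0 hy
      have hred := isReducedOn_of_field hy (fun t ht => (hfr t ht).1.1) (fun t ht => (hfr t ht).2.1)
      have hy0' : (y 0).1 = s₀.rel ∧ (y 0).2.1.1 = s₀.v1.x ∧ (y 0).2.2.1 = s₀.v2.x := by
        rw [hy0]; exact ⟨rfl, rfl, rfl⟩
      obtain ⟨h1, h2, h3⟩ := hred.lyap_le H.sign H.potential H.potential_zero H.potential_top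
        H.gains (v := h ‖s₀.rel‖ - Real.log (gap s₀.rel s₀.v1.x s₀.v2.x))
        (by rw [hy0'.1]; exact hr) (by rw [hy0'.1, hy0'.2.1, hy0'.2.2]; exact hg)
        (by rw [hy0'.1, hy0'.2.1, hy0'.2.2]) t ht
      have hbt := hb _ _ _ h1 (hred.norm₁ t ht) (hred.norm₂ t ht) h2 h3
      exact hmem _ hbt.1 hbt.2.1 (hfr t ht).1.1 (hfr t ht).2.1)
  exact exists_trajectory_of_field hy0 hy

theorem Vehicle.ext_of_frame {a b : Vehicle} (hp : a.pos = b.pos) (hf : a.frame = b.frame) :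
    a = b := by
  obtain ⟨p, x, y, z, _, _⟩ := a
  obtain ⟨p', x', y', z', _, _⟩ := b
  simp only [Vehicle.frame, Prod.mk.injEq] at hp hf
  obtain ⟨rfl, rfl, rfl⟩ := hf
  subst hp
  rfl

theorem trajectory_unique (H : GainConditions σ f h μ η) {τ : ℝ} {s s' : ℝ → Pair}
    (hs : IsTrajectoryOn σ η μ f (Icc 0 τ) s) (hs' : IsTrajectoryOn σ η μ f (Icc 0 τ) s')
    (h0 : (s 0).shape ∈ Lam) (heq : s 0 = s' 0) : EqOn s s' (Icc 0 τ) := by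
  have hL := hs.mem_Lam H h0
  have hL' := hs'.mem_Lam H (heq ▸ h0)
  rw [isTrajectoryOn_iff] at hs hs'
  have hst := eqOn_of_locallyLipschitzOn (locallyLipschitzOn_field σ H.lip_η H.lip_μ H.lip_f)
    hs.2.2 hs'.2.2 (fun t ht => (mem_Lam_iff.1 (hL t ht)).1)
    (fun t ht => (mem_Lam_iff.1 (hL' t ht)).1) (by rw [heq])
  have hx1 : ∀ t ∈ Icc 0 τ, (s t).v1.x = (s' t).v1.x := fun t ht =>
    congrArg (fun q : State => q.2.1.1) (hst ht)
  have hx2 : ∀ t ∈ Icc 0 τ, (s t).v2.x = (s' t).v2.x := fun t ht =>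
    congrArg (fun q : State => q.2.2.1) (hst ht)
  intro t ht
  have hp1 := eq_of_hasDerivWithinAt_zero
    (fun t ht => by
      have := (hs.1 t ht).sub (hs'.1 t ht)
      rwa [hx1 t ht, sub_self] at this) t ht
  have hp2 := eq_of_hasDerivWithinAt_zero
    (fun t ht => by
      have := (hs.2.1 t ht).sub (hs'.2.1 t ht)
      rwa [hx2 t ht, sub_self] at this) t ht
  simp only [Pi.sub_apply, heq, sub_self] at hp1 hp2
  have e1 : (s t).v1 = (s' t).v1 := Vehicle.ext_of_frame (sub_eq_zero.1 hp1)
    (congrArg (fun q : State => q.2.1) (hst ht))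
  have e2 : (s t).v2 = (s' t).v2 := Vehicle.ext_of_frame (sub_eq_zero.1 hp2)
    (congrArg (fun q : State => q.2.2) (hst ht))
  calc s t = ⟨(s t).v1, (s t).v2⟩ := rfl
    _ = ⟨(s' t).v1, (s' t).v2⟩ := by rw [e1, e2]
    _ = s' t := rfl

/-- The global trajectory from the same initial state agrees with the given one on each [0, t] by
uniqueness. -/
theorem exists_extension (H : GainConditions σ f h μ η) {T : ℝ} {s : ℝ → Pair}
    (hs : IsTrajectoryOn σ η μ f (Ico 0 T) s) (h0 : (s 0).shape ∈ Lam) :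
    ∃ s' : ℝ → Pair, IsTrajectoryOn σ η μ f (Ici 0) s' ∧ ∀ t ∈ Ico 0 T, s' t = s t := by
  obtain ⟨s', hs', hs0⟩ := exists_trajectory H h0
  refine ⟨s', hs', fun t ht => ?_⟩
  exact (trajectory_unique H (hs.mono fun x hx => ⟨hx.1, hx.2.trans_lt ht.2⟩)
    (hs'.mono Icc_subset_Ici_self) h0 hs0.symm ⟨ht.1, le_rfl⟩).symm

end Global

/-! ### Functions on the space of shapes and their values at `gap` = 2 -/

section Convergence

/-- `r/|r| · x₁` on the space of shapes. -/
noncomputable def cosine₁ (p : Shape) : ℝ := inner ℝ (unitDir p.1) (p.2.1 : E3)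

/-- `r/|r| · x₂` on the space of shapes. -/
noncomputable def cosine₂ (p : Shape) : ℝ := inner ℝ (unitDir p.1) (p.2.2 : E3)

/-- The function `gap` on the space of shapes. -/
noncomputable def shapeGap (p : Shape) : ℝ := gap p.1 p.2.1 p.2.2

theorem norm_head (x : S2) : ‖(x : E3)‖ = 1 := by simp

theorem continuousAt_gain {g : ℝ → ℝ} (hg : LocallyLipschitzOn (Ioi 0) g) {p : Shape}
    (hp : p.1 ≠ 0) : ContinuousAt (fun p : Shape => g ‖p.1‖) p :=
  ContinuousAt.comp (f := fun p : Shape => ‖p.1‖) (g := g)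
    (hg.continuousOn.continuousAt (Ioi_mem_nhds (norm_pos_iff.2 hp))) (by fun_prop)

theorem continuousAt_shapeDir {p : Shape} (hp : p.1 ≠ 0) :
    ContinuousAt (fun p : Shape => unitDir p.1) p :=
  ContinuousAt.comp (g := unitDir) (continuousAt_unitDir hp) continuousAt_fst

theorem continuous_head₁ : Continuous fun p : Shape => (p.2.1 : E3) := by fun_prop

theorem continuous_head₂ : Continuous fun p : Shape => (p.2.2 : E3) := by fun_prop

theorem continuousAt_cosine₁ {p : Shape} (hp : p.1 ≠ 0) : ContinuousAt cosine₁ p :=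
  (continuousAt_shapeDir hp).inner (𝕜 := ℝ) continuous_head₁.continuousAt

theorem continuousAt_cosine₂ {p : Shape} (hp : p.1 ≠ 0) : ContinuousAt cosine₂ p :=
  (continuousAt_shapeDir hp).inner (𝕜 := ℝ) continuous_head₂.continuousAt

theorem continuous_headInner : Continuous fun p : Shape => (inner ℝ (p.2.2 : E3) (p.2.1 : E3) : ℝ) :=
  continuous_head₂.inner continuous_head₁

theorem continuousAt_shapeGap {p : Shape} (hp : p.1 ≠ 0) : ContinuousAt shapeGap p :=
  (continuousAt_const.sub continuous_headInner.continuousAt).add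
    ((continuousAt_const.mul (continuousAt_cosine₂ hp)).mul (continuousAt_cosine₁ hp))

/-- The steering vector of the first vehicle minus its component along the heading. -/
noncomputable def turn₁ (σ : ℝ) (η μ f : ℝ → ℝ) (p : Shape) : E3 :=
  steer σ η μ f (-p.1) p.2.1 p.2.2
    - (inner ℝ (steer σ η μ f (-p.1) p.2.1 p.2.2) (p.2.1 : E3) : ℝ) • (p.2.1 : E3)

/-- The steering vector of the second vehicle minus its component along the heading. -/
noncomputable def turn₂ (σ : ℝ) (η μ f : ℝ → ℝ) (p : Shape) : E3 :=
  steer σ η μ f p.1 p.2.2 p.2.1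
    - (inner ℝ (steer σ η μ f p.1 p.2.2 p.2.1) (p.2.2 : E3) : ℝ) • (p.2.2 : E3)

theorem continuousAt_turn₁ (H : GainConditions σ f h μ η) {p : Shape} (hp : p.1 ≠ 0) :
    ContinuousAt (turn₁ σ η μ f) p := by
  have hs : ContinuousAt (fun p : Shape => steer σ η μ f (-p.1) p.2.1 p.2.2) p := by
    simp only [steer, norm_neg, unitDir_neg]
    have hd := (continuousAt_shapeDir hp).neg
    exact (((((continuousAt_const.mul (continuousAt_gain H.lip_η hp)).mul
      (hd.inner (𝕜 := ℝ) continuous_head₁.continuousAt)).add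
      ((continuousAt_const.mul (continuousAt_gain H.lip_μ hp)).mul
      (hd.inner (𝕜 := ℝ) continuous_head₂.continuousAt))).sub
      (continuousAt_gain H.lip_f hp)).smul hd).sub
      ((continuousAt_gain H.lip_μ hp).smul continuous_head₂.continuousAt)
  exact hs.sub ((hs.inner (𝕜 := ℝ) continuous_head₁.continuousAt).smul continuous_head₁.continuousAt)

theorem continuousAt_turn₂ (H : GainConditions σ f h μ η) {p : Shape} (hp : p.1 ≠ 0) :
    ContinuousAt (turn₂ σ η μ f) p := by
  have hs : ContinuousAt (fun p : Shape => steer σ η μ f p.1 p.2.2 p.2.1) p := by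
    have hd := continuousAt_shapeDir hp
    exact (((((continuousAt_const.mul (continuousAt_gain H.lip_η hp)).mul
      (hd.inner (𝕜 := ℝ) continuous_head₂.continuousAt)).add
      ((continuousAt_const.mul (continuousAt_gain H.lip_μ hp)).mul
      (hd.inner (𝕜 := ℝ) continuous_head₁.continuousAt))).sub
      (continuousAt_gain H.lip_f hp)).smul hd).sub
      ((continuousAt_gain H.lip_μ hp).smul continuous_head₁.continuousAt)
  exact hs.sub ((hs.inner (𝕜 := ℝ) continuous_head₂.continuousAt).smul continuous_head₂.continuousAt)

/-- The rate of change of `cosine₁`. -/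
noncomputable def cosineRate₁ (σ : ℝ) (η μ f : ℝ → ℝ) (p : Shape) : ℝ :=
  IsReducedOn.rate₁ σ η μ f p.1 p.2.1 p.2.2

/-- The rate of change of `cosine₂`. -/
noncomputable def cosineRate₂ (σ : ℝ) (η μ f : ℝ → ℝ) (p : Shape) : ℝ :=
  IsReducedOn.rate₂ σ η μ f p.1 p.2.1 p.2.2

theorem continuousAt_cosineRate₁ (H : GainConditions σ f h μ η) {p : Shape} (hp : p.1 ≠ 0) :
    ContinuousAt (cosineRate₁ σ η μ f) p := by
  have ha := continuousAt_cosine₁ hp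
  have hb := continuousAt_cosine₂ hp
  have hc := continuous_headInner.continuousAt (x := p)
  have hn : ContinuousAt (fun p : Shape => ‖p.1‖) p := by fun_prop
  exact ((((hc.sub continuousAt_const).sub ((hb.sub ha).mul ha)).div hn
    (norm_ne_zero_iff.2 hp)).add ((((continuousAt_const.mul (continuousAt_gain H.lip_η hp)).mul
    ha).add (continuousAt_gain H.lip_f hp)).mul (continuousAt_const.sub (ha.pow 2)))).add
    ((continuousAt_gain H.lip_μ hp).mul (((hb.sub (ha.mul hc)).neg).add
    ((continuousAt_const.mul hb).mul (continuousAt_const.sub (ha.pow 2)))))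

theorem continuousAt_cosineRate₂ (H : GainConditions σ f h μ η) {p : Shape} (hp : p.1 ≠ 0) :
    ContinuousAt (cosineRate₂ σ η μ f) p := by
  have ha := continuousAt_cosine₁ hp
  have hb := continuousAt_cosine₂ hp
  have hc := continuous_headInner.continuousAt (x := p)
  have hn : ContinuousAt (fun p : Shape => ‖p.1‖) p := by fun_prop
  exact ((((continuousAt_const.sub hc).sub ((hb.sub ha).mul hb)).div hn
    (norm_ne_zero_iff.2 hp)).add ((((continuousAt_const.mul (continuousAt_gain H.lip_η hp)).mul
    hb).sub (continuousAt_gain H.lip_f hp)).mul (continuousAt_const.sub (hb.pow 2)))).add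
    ((continuousAt_gain H.lip_μ hp).mul (((ha.sub (hb.mul hc)).neg).add
    ((continuousAt_const.mul ha).mul (continuousAt_const.sub (hb.pow 2)))))

theorem continuousAt_lyapRate (H : GainConditions σ f h μ η) {p : Shape} (hp : p.1 ≠ 0)
    (hg : shapeGap p ≠ 0) :
    ContinuousAt (fun p : Shape => lyapRate σ η μ p.1 p.2.1 p.2.2) p := by
  have ha := continuousAt_cosine₁ hp
  have hb := continuousAt_cosine₂ hp
  have hq := continuousAt_shapeGap hp
  exact ((continuousAt_const.mul (continuousAt_gain H.lip_μ hp)).mul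
    (continuousAt_const.sub hq)).neg.sub ((continuousAt_const.mul
    (continuousAt_gain H.lip_η hp)).mul ((((ha.add hb).pow 2).div hq hg).sub
    ((ha.pow 2).add (hb.pow 2))))

theorem cosine₁_sq_le (p : Shape) (hp : p.1 ≠ 0) : cosine₁ p ^ 2 ≤ 1 := by
  have := sq_inner_le_norm_sq (v := (p.2.1 : E3)) (norm_unitDir hp)
  rwa [norm_head, one_pow] at this

section Equilibria

variable {p : Shape}

theorem head₂_eq_of_shapeGap (hp : p.1 ≠ 0) (hg : shapeGap p = 2) :
    (p.2.2 : E3) = (2 * cosine₁ p) • unitDir p.1 - p.2.1 :=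
  eq_reflection_of_gap_eq_two hp (norm_head _) (norm_head _) hg

theorem cosine₂_eq_of_shapeGap (hp : p.1 ≠ 0) (hg : shapeGap p = 2) :
    cosine₂ p = cosine₁ p := by
  have := sq_sub_inner_le hp (norm_head p.2.1) (norm_head p.2.2)
  rw [show gap p.1 (p.2.1 : E3) p.2.2 = 2 from hg, sub_self, mul_zero] at this
  exact sub_eq_zero.1 (pow_eq_zero_iff two_ne_zero |>.1 (le_antisymm this (sq_nonneg _)))

theorem headInner_eq_of_shapeGap (hp : p.1 ≠ 0) (hg : shapeGap p = 2) :
    (inner ℝ (p.2.2 : E3) (p.2.1 : E3) : ℝ) = 2 * cosine₁ p ^ 2 - 1 := by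
  have h1 : shapeGap p = 1 - (inner ℝ (p.2.2 : E3) (p.2.1 : E3)) + 2 * cosine₂ p * cosine₁ p := rfl
  rw [hg, cosine₂_eq_of_shapeGap hp hg] at h1
  linarith

/-- When `gap` = 2 this rate and that of `cosine₂` differ only in the sign of f - 2/|r|. Their
difference isolates the circling condition; once that term vanishes, the η-term governs the cosine.
-/
theorem cosineRate₁_eq_of_shapeGap (hp : p.1 ≠ 0) (hg : shapeGap p = 2) :
    cosineRate₁ σ η μ f p =
      (1 - cosine₁ p ^ 2) * (f ‖p.1‖ - 2 / ‖p.1‖ + σ * η ‖p.1‖ * cosine₁ p) := by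
  have h1 : cosineRate₁ σ η μ f p = ((inner ℝ (p.2.2 : E3) (p.2.1 : E3)) - 1
      - (cosine₂ p - cosine₁ p) * cosine₁ p) / ‖p.1‖
      + (σ * η ‖p.1‖ * cosine₁ p + f ‖p.1‖) * (1 - cosine₁ p ^ 2)
      + μ ‖p.1‖ * (-(cosine₂ p - cosine₁ p * (inner ℝ (p.2.2 : E3) (p.2.1 : E3)))
        + 2 * cosine₂ p * (1 - cosine₁ p ^ 2)) := rfl
  have := norm_ne_zero_iff.2 hp
  rw [h1, cosine₂_eq_of_shapeGap hp hg, headInner_eq_of_shapeGap hp hg]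
  field_simp
  ring

theorem cosineRate₂_eq_of_shapeGap (hp : p.1 ≠ 0) (hg : shapeGap p = 2) :
    cosineRate₂ σ η μ f p =
      (1 - cosine₁ p ^ 2) * (2 / ‖p.1‖ - f ‖p.1‖ + σ * η ‖p.1‖ * cosine₁ p) := by
  have h1 : cosineRate₂ σ η μ f p = (1 - (inner ℝ (p.2.2 : E3) (p.2.1 : E3))
      - (cosine₂ p - cosine₁ p) * cosine₂ p) / ‖p.1‖
      + (σ * η ‖p.1‖ * cosine₂ p - f ‖p.1‖) * (1 - cosine₂ p ^ 2)
      + μ ‖p.1‖ * (-(cosine₁ p - cosine₂ p * (inner ℝ (p.2.2 : E3) (p.2.1 : E3)))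
        + 2 * cosine₁ p * (1 - cosine₂ p ^ 2)) := rfl
  have := norm_ne_zero_iff.2 hp
  rw [h1, cosine₂_eq_of_shapeGap hp hg, headInner_eq_of_shapeGap hp hg]
  field_simp
  ring

/-- Here x₂ = 2a u - x₁. If a² = 1 then x₁ = ±u = x₂; otherwise a = 0, so x₂ = -x₁ and the first
condition yields f = 2/|r|. -/
theorem mem_limitSet (hp : p.1 ≠ 0) (hg : shapeGap p = 2)
    (h1 : (1 - cosine₁ p ^ 2) * (f ‖p.1‖ - 2 / ‖p.1‖) = 0)
    (h2 : cosine₁ p ^ 2 * (1 - cosine₁ p ^ 2) = 0) : p ∈ limitSet f := by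
  have hx2 := head₂_eq_of_shapeGap hp hg
  have hLam : p ∈ Lam := by
    refine ⟨?_, norm_pos_iff.2 hp⟩
    change shapeGap p ≠ 0
    rw [hg]; exact two_ne_zero
  refine ⟨?_, hLam⟩
  by_cases ha : cosine₁ p ^ 2 = 1
  · right
    have hx1 : (p.2.1 : E3) = cosine₁ p • unitDir p.1 := by
      -- Equality in Cauchy–Schwarz: |x₁ - a u|² = 1 - a² = 0.
      rw [← sub_eq_zero, ← norm_eq_zero, ← sq_eq_zero_iff, norm_sub_sq_real, norm_head, norm_smul,
        norm_unitDir hp, real_inner_smul_right, real_inner_comm]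
      change 1 ^ 2 - 2 * (cosine₁ p * cosine₁ p) + (‖cosine₁ p‖ * 1) ^ 2 = 0
      rw [mul_one, Real.norm_eq_abs, sq_abs]
      linarith
    have hx12 : (p.2.1 : E3) = p.2.2 := by
      rw [hx2, two_mul, add_smul, ← hx1, add_sub_cancel_right]
    refine ⟨hx12, ?_⟩
    rcases sq_eq_one_iff.1 ha with h | h
    · left; rw [hx1, h, one_smul]
    · right; rw [hx1, h, neg_one_smul]
  · left
    have hne : 1 - cosine₁ p ^ 2 ≠ 0 := fun h => ha (by linarith)
    have ha0 : cosine₁ p = 0 :=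
      pow_eq_zero_iff two_ne_zero |>.1 ((mul_eq_zero.1 h2).resolve_right hne)
    refine ⟨?_, ?_, sub_eq_zero.1 ((mul_eq_zero.1 h1).resolve_left hne)⟩
    · rw [hx2, ha0, mul_zero, zero_smul, zero_sub, neg_neg]
    · rw [← norm_smul_unitDir hp, real_inner_smul_left]
      change ‖p.1‖ * cosine₁ p = 0
      rw [ha0, mul_zero]

end Equilibria

end Convergence

/-! ### Convergence to the limit set -/

section Convergence

theorem isCompact_shapeRegion {ρ₀ ρ₁ q₀ : ℝ} (hρ₀ : 0 < ρ₀) :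
    IsCompact {p : Shape | ρ₀ ≤ ‖p.1‖ ∧ ‖p.1‖ ≤ ρ₁ ∧ q₀ ≤ shapeGap p} := by
  have hball : IsCompact ((Metric.closedBall (0 : E3) ρ₁) ×ˢ (univ : Set (S2 × S2))) :=
    (isCompact_closedBall _ _).prod isCompact_univ
  have hK : IsCompact ((Metric.closedBall (0 : E3) ρ₁) ×ˢ (univ : Set (S2 × S2)) ∩
      {p : Shape | ρ₀ ≤ ‖p.1‖}) :=
    hball.inter_right (isClosed_le continuous_const (by fun_prop))
  have hc : ContinuousOn shapeGap ((Metric.closedBall (0 : E3) ρ₁) ×ˢ (univ : Set (S2 × S2)) ∩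
      {p : Shape | ρ₀ ≤ ‖p.1‖}) := fun p hp =>
    (continuousAt_shapeGap (norm_pos_iff.1 (hρ₀.trans_le hp.2))).continuousWithinAt
  have hcomp := hK.of_isClosed_subset (hc.preimage_isClosed_of_isClosed hK.isClosed isClosed_Ici
    (t := Ici q₀)) inter_subset_left
  convert hcomp using 1
  ext p
  simp only [mem_ofPred_eq, mem_inter_iff, mem_prod, mem_closedBall_zero_iff, mem_univ, and_true,
    mem_preimage, mem_Ici]
  tauto

/-- All velocities are bounded on `K`, so the shape is Lipschitz in time. This supplies the uniform
continuity that Barbalat's lemma asks for. -/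
theorem uniformContinuousOn_shape (H : GainConditions σ f h μ η) {s : ℝ → Pair}
    (hs : IsTrajectoryOn σ η μ f (Ici 0) s) {K : Set Shape} (hK : IsCompact K)
    (hK0 : ∀ p ∈ K, p.1 ≠ 0) (hsK : ∀ t ∈ Ici (0 : ℝ), (s t).shape ∈ K) :
    UniformContinuousOn (fun t => (s t).shape) (Ici 0) := by
  have hred := hs.isReducedOn
  obtain ⟨M₁, hM₁⟩ := hK.exists_bound_of_continuousOn
    (fun p hp => (continuousAt_turn₁ H (hK0 p hp)).continuousWithinAt)
  obtain ⟨M₂, hM₂⟩ := hK.exists_bound_of_continuousOn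
    (fun p hp => (continuousAt_turn₂ H (hK0 p hp)).continuousWithinAt)
  have hr : LipschitzOnWith 2 (fun t => (s t).rel) (Ici 0) :=
    (convex_Ici 0).lipschitzOnWith_of_nnnorm_hasDerivWithin_le hred.rel fun t ht => by
      rw [← NNReal.coe_le_coe, coe_nnnorm]
      refine (norm_sub_le _ _).trans ?_
      rw [hred.norm₁ t ht, hred.norm₂ t ht]
      norm_num
  have h1 : LipschitzOnWith M₁.toNNReal (fun t => (s t).v1.x) (Ici 0) :=
    (convex_Ici 0).lipschitzOnWith_of_nnnorm_hasDerivWithin_le hred.head₁ fun t ht => by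
      rw [← NNReal.coe_le_coe, coe_nnnorm]
      exact (hM₁ _ (hsK t ht)).trans (Real.le_coe_toNNReal _)
  have h2 : LipschitzOnWith M₂.toNNReal (fun t => (s t).v2.x) (Ici 0) :=
    (convex_Ici 0).lipschitzOnWith_of_nnnorm_hasDerivWithin_le hred.head₂ fun t ht => by
      rw [← NNReal.coe_le_coe, coe_nnnorm]
      exact (hM₂ _ (hsK t ht)).trans (Real.le_coe_toNNReal _)
  have h1' : LipschitzOnWith M₁.toNNReal (fun t => (s t).shape.2.1) (Ici 0) := h1
  have h2' : LipschitzOnWith M₂.toNNReal (fun t => (s t).shape.2.2) (Ici 0) := h2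
  exact (hr.prodMk (h1'.prodMk h2')).uniformContinuousOn

theorem tendsto_infDist_limitSet (H : GainConditions σ f h μ η) {s : ℝ → Pair}
    (hs : IsTrajectoryOn σ η μ f (Ici 0) s) (h0 : (s 0).shape ∈ Lam) :
    Tendsto (fun t => Metric.infDist (s t).shape (limitSet f)) atTop (𝓝 0) := by
  have hred := hs.isReducedOn
  obtain ⟨hr0, hg0⟩ := mem_Lam_iff.1 h0
  set V : ℝ → ℝ := fun t =>
    h ‖(s t).rel‖ - Real.log (gap (s t).rel (s t).v1.x (s t).v2.x)
  obtain ⟨ρ₀, ρ₁, q₀, hρ₀, hq₀, hb⟩ := exists_bounds_of_lyap_le H.potential H.potential_zero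
    H.potential_top (V 0)
  have hgood : ∀ t, 0 ≤ t → (s t).rel ≠ 0 ∧ 0 < gap (s t).rel (s t).v1.x (s t).v2.x ∧ V t ≤ V 0 :=
    fun t ht => (hred.mono (show Icc 0 t ⊆ Ici 0 from Icc_subset_Ici_self)).lyap_le H.sign H.potential
      H.potential_zero H.potential_top H.gains hr0 hg0 le_rfl t ⟨ht, le_rfl⟩
  set K : Set Shape := {p | ρ₀ ≤ ‖p.1‖ ∧ ‖p.1‖ ≤ ρ₁ ∧ q₀ ≤ shapeGap p}
  have hK : IsCompact K := isCompact_shapeRegion hρ₀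
  have hK0 : ∀ p ∈ K, p.1 ≠ 0 := fun p hp => norm_pos_iff.1 (hρ₀.trans_le hp.1)
  have hsK : ∀ t ∈ Ici (0 : ℝ), (s t).shape ∈ K := fun t ht =>
    hb _ _ _ (hgood t ht).1 (hred.norm₁ t ht) (hred.norm₂ t ht) (hgood t ht).2.1 (hgood t ht).2.2
  have hsK' : ∀ᶠ t in atTop, (s t).shape ∈ K := by
    filter_upwards [eventually_ge_atTop 0] with t ht using hsK t ht
  have hu := uniformContinuousOn_shape H hs hK hK0 hsK
  have hucomp : ∀ {G : Shape → ℝ}, ContinuousOn G K →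
      UniformContinuousOn (fun t => G (s t).shape) (Ici 0) := fun hG =>
    (hK.uniformContinuousOn_of_continuous hG).comp hu hsK
  have hI : ∀ t : ℝ, 0 < t → Ici (0 : ℝ) ∈ 𝓝 t := fun t ht => Ici_mem_nhds ht
  have hcgap : ContinuousOn shapeGap K := fun p hp =>
    (continuousAt_shapeGap (hK0 p hp)).continuousWithinAt
  have hca : ContinuousOn cosine₁ K := fun p hp =>
    (continuousAt_cosine₁ (hK0 p hp)).continuousWithinAt
  have hcb : ContinuousOn cosine₂ K := fun p hp =>
    (continuousAt_cosine₂ (hK0 p hp)).continuousWithinAt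
  have hcr1 : ContinuousOn (cosineRate₁ σ η μ f) K := fun p hp =>
    (continuousAt_cosineRate₁ H (hK0 p hp)).continuousWithinAt
  have hcr2 : ContinuousOn (cosineRate₂ σ η μ f) K := fun p hp =>
    (continuousAt_cosineRate₂ H (hK0 p hp)).continuousWithinAt
  have hcL : ContinuousOn (fun p : Shape => lyapRate σ η μ p.1 p.2.1 p.2.2) K := fun p hp =>
    (continuousAt_lyapRate H (hK0 p hp) (hq₀.trans_le hp.2.2).ne').continuousWithinAt
  have hcη : ContinuousOn (fun p : Shape => η ‖p.1‖) K := fun p hp =>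
    (continuousAt_gain H.lip_η (hK0 p hp)).continuousWithinAt
  have hcf : ContinuousOn (fun p : Shape => f ‖p.1‖ - 2 / ‖p.1‖) K := fun p hp =>
    ((continuousAt_gain H.lip_f (hK0 p hp)).sub (continuousAt_const.div
      (show ContinuousAt (fun p : Shape => ‖p.1‖) p by fun_prop) (norm_ne_zero_iff.2 (hK0 p hp)))).continuousWithinAt
  obtain ⟨l, hl⟩ : ∃ l, Tendsto V atTop (𝓝 l) := by
    obtain ⟨m, hm⟩ := exists_le_potential H.potential H.potential_zero H.potential_top
    -- V is controlled only for t ≥ 0; freezing it earlier gives a function monotone on the whole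
    -- line.
    have hanti : Antitone fun t => V (max t 0) := fun a b hab =>
      (hred.mono (show Icc 0 (max b 0) ⊆ Ici 0 from Icc_subset_Ici_self)).antitoneOn_lyap H.sign H.potential H.gains
        (fun t ht => (hgood t ht.1).1) (fun t ht => (hgood t ht.1).2.1)
        ⟨le_max_right _ _, max_le_max_right _ hab⟩ ⟨le_max_right _ _, le_rfl⟩
        (max_le_max_right _ hab)
    have hbdd : BddBelow (range fun t => V (max t 0)) := by
      refine ⟨m - Real.log 2, ?_⟩
      rintro _ ⟨t, rfl⟩
      have ht : (0 : ℝ) ≤ max t 0 := le_max_right _ _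
      have h1 := hm _ (norm_pos_iff.2 (hgood _ ht).1)
      have h2 := Real.log_le_log (hgood _ ht).2.1
        (gap_le_two (hgood _ ht).1 (hred.norm₁ _ ht) (hred.norm₂ _ ht))
      change m - Real.log 2 ≤ h _ - Real.log _
      linarith
    refine ⟨_, (tendsto_atTop_ciInf hanti hbdd).congr' ?_⟩
    filter_upwards [eventually_ge_atTop 0] with t ht
    rw [max_eq_left ht]
  have hrate : Tendsto (fun t => lyapRate σ η μ (s t).rel (s t).v1.x (s t).v2.x) atTop (𝓝 0) :=
    tendsto_deriv_zero_of_uniformContinuousOn (fun t ht =>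
      (hred.hasDerivWithinAt_lyap H.potential ht.le (hgood t ht.le).1
        (hgood t ht.le).2.1.ne').hasDerivAt (hI t ht)) hl (hucomp hcL)
  have hgap : Tendsto (fun t => 2 - shapeGap (s t).shape) atTop (𝓝 0) := by
    refine tendsto_zero_of_zeros_subset hK hsK' hcL (continuousOn_const.sub hcgap) ?_ hrate
    intro p hp hz
    have hn := norm_pos_iff.2 (hK0 p hp)
    obtain ⟨hm1, hm2⟩ := H.gains _ hn
    have h1 := lyapRate_le (μ := μ) H.sign (hK0 p hp) (norm_head p.2.1) (norm_head p.2.2)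
      (hq₀.trans_le hp.2.2) (show 0 < η ‖p.1‖ by linarith)
    have h2 := gap_le_two (hK0 p hp) (norm_head p.2.1) (norm_head p.2.2)
    rw [hz] at h1
    have h3 : 2 - gap p.1 p.2.1 p.2.2 ≤ 0 := by
      by_contra! hlt
      nlinarith [mul_pos (show 0 < 2 * μ ‖p.1‖ - η ‖p.1‖ by linarith) hlt]
    change 2 - gap p.1 p.2.1 p.2.2 = 0
    linarith
  have hdiff : Tendsto (fun t => cosine₂ (s t).shape - cosine₁ (s t).shape) atTop (𝓝 0) :=
    tendsto_zero_of_zeros_subset hK hsK' (continuousOn_const.sub hcgap) (hcb.sub hca)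
      (fun p hp hz => sub_eq_zero.2 (cosine₂_eq_of_shapeGap (hK0 p hp)
        (sub_eq_zero.1 (show 2 - shapeGap p = 0 from hz)).symm)) hgap
  have hda : ∀ t, 0 < t → HasDerivAt (fun t => cosine₁ (s t).shape)
      (cosineRate₁ σ η μ f (s t).shape) t := fun t ht =>
    (hred.hasDerivWithinAt_inner₁ ht.le (hgood t ht.le).1).hasDerivAt (hI t ht)
  have hdb : ∀ t, 0 < t → HasDerivAt (fun t => cosine₂ (s t).shape)
      (cosineRate₂ σ η μ f (s t).shape) t := fun t ht =>
    (hred.hasDerivWithinAt_inner₂ ht.le (hgood t ht.le).1).hasDerivAt (hI t ht)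
  -- Second use of Barbalat's lemma, now on b - a, whose limit is already known to be 0.
  have hddiff : Tendsto (fun t => cosineRate₂ σ η μ f (s t).shape - cosineRate₁ σ η μ f (s t).shape)
      atTop (𝓝 0) :=
    tendsto_deriv_zero_of_uniformContinuousOn (fun t ht => (hdb t ht).sub (hda t ht)) hdiff
      (hucomp (hcr2.sub hcr1))
  -- A sum of squares packs the conditions `gap` = 2 and equal cosine rates into the zeros of one
  -- function.
  let G : Shape → ℝ := fun p => (2 - shapeGap p) ^ 2
    + (cosineRate₂ σ η μ f p - cosineRate₁ σ η μ f p) ^ 2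
  have hG : ContinuousOn G K := ((continuousOn_const.sub hcgap).pow 2).add ((hcr2.sub hcr1).pow 2)
  have hGlim : Tendsto (fun t => G (s t).shape) atTop (𝓝 0) := by
    simpa using (hgap.pow 2).add (hddiff.pow 2)
  have hGzero : ∀ p ∈ K, G p = 0 → shapeGap p = 2 ∧
      (1 - cosine₁ p ^ 2) * (f ‖p.1‖ - 2 / ‖p.1‖) = 0 := by
    intro p hp hz
    have h1 := sq_nonneg (2 - shapeGap p)
    have h2 := sq_nonneg (cosineRate₂ σ η μ f p - cosineRate₁ σ η μ f p)
    have hz' : (2 - shapeGap p) ^ 2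
      + (cosineRate₂ σ η μ f p - cosineRate₁ σ η μ f p) ^ 2 = 0 := hz
    have hgz : 2 - shapeGap p = 0 := pow_eq_zero_iff two_ne_zero |>.1 (by linarith)
    have hg : shapeGap p = 2 := by linarith
    have hd : cosineRate₂ σ η μ f p - cosineRate₁ σ η μ f p = 0 :=
      pow_eq_zero_iff two_ne_zero |>.1 (by linarith)
    rw [cosineRate₁_eq_of_shapeGap (hK0 p hp) hg, cosineRate₂_eq_of_shapeGap (hK0 p hp) hg] at hd
    exact ⟨hg, by linarith⟩
  have hforce : Tendsto (fun t => (1 - cosine₁ (s t).shape ^ 2) *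
      (f ‖(s t).shape.1‖ - 2 / ‖(s t).shape.1‖)) atTop (𝓝 0) :=
    tendsto_zero_of_zeros_subset hK hsK' hG ((continuousOn_const.sub (hca.pow 2)).mul hcf)
      (fun p hp hz => (hGzero p hp hz).2) hGlim
  -- This is σ(a²)' minus its limiting form 2η a²(1-a²); it vanishes where `G` does, because σ² = 1.
  have hcE : ContinuousOn (fun p : Shape => σ * (2 * cosine₁ p * cosineRate₁ σ η μ f p)
      - 2 * η ‖p.1‖ * (cosine₁ p ^ 2 * (1 - cosine₁ p ^ 2))) K :=
    (continuousOn_const.mul ((continuousOn_const.mul hca).mul hcr1)).sub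
      ((continuousOn_const.mul hcη).mul ((hca.pow 2).mul (continuousOn_const.sub (hca.pow 2))))
  have hσσ : σ * σ = 1 := by rcases H.sign with h | h <;> rw [h] <;> norm_num
  have herr := tendsto_zero_of_zeros_subset hK hsK' hG hcE (fun p hp hz => by
    obtain ⟨hg, hf0⟩ := hGzero p hp hz
    rw [cosineRate₁_eq_of_shapeGap (hK0 p hp) hg]
    linear_combination (2 * σ * cosine₁ p) * hf0 +
      (2 * η ‖p.1‖ * (cosine₁ p ^ 2 * (1 - cosine₁ p ^ 2))) * hσσ) hGlim
  -- A uniform positive lower bound of η on the compact region.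
  obtain ⟨k, hk, hkη⟩ := hK.exists_forall_le' hcη (a := 0) fun p hp => by
    linarith [(H.gains _ (norm_pos_iff.2 (hK0 p hp))).2]
  have hsq : ∀ t, 0 < t → cosine₁ (s t).shape ^ 2 ∈ Icc (0 : ℝ) 1 := fun t ht =>
    ⟨sq_nonneg _, cosine₁_sq_le _ (hgood t ht.le).1⟩
  have hdsq : ∀ t, 0 < t → HasDerivAt (fun t => cosine₁ (s t).shape ^ 2)
      (2 * cosine₁ (s t).shape * cosineRate₁ σ η μ f (s t).shape) t := fun t ht => by
    exact ((hda t ht).pow 2).congr_deriv (by simp)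
  have hprod : ∀ t, 0 < t → 2 * k * (cosine₁ (s t).shape ^ 2 * (1 - cosine₁ (s t).shape ^ 2)) ≤
      2 * η ‖(s t).shape.1‖ * (cosine₁ (s t).shape ^ 2 * (1 - cosine₁ (s t).shape ^ 2)) :=
    fun t ht => mul_le_mul_of_nonneg_right (by linarith [hkη _ (hsK t ht.le)])
      (mul_nonneg (hsq t ht).1 (sub_nonneg.2 (hsq t ht).2))
  have hdich : Tendsto (fun t => cosine₁ (s t).shape ^ 2 * (1 - cosine₁ (s t).shape ^ 2)) atTop
      (𝓝 0) := by
    -- The quantity driven upwards is a² for σ = 1 and 1 - a² for σ = -1; the product w(1-w) is the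
    -- same.
    rcases H.sign with hσ | hσ
    · refine tendsto_mul_one_sub_zero (k := 2 * k) (by linarith) hsq hdsq (fun t ht => ?_) herr
      have := hprod t ht
      simp only [hσ, one_mul] at this ⊢
      linarith
    · have := tendsto_mul_one_sub_zero (w := fun t => 1 - cosine₁ (s t).shape ^ 2) (k := 2 * k)
        (by linarith) (fun t ht => ⟨sub_nonneg.2 (hsq t ht).2, by linarith [(hsq t ht).1]⟩)
        (fun t ht => (hdsq t ht).const_sub 1) (fun t ht => by
          have := hprod t ht
          simp only [hσ] at this ⊢
          linarith) herr
      refine this.congr fun t => by ring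
  -- `Metric.infDist` to the empty set would be 0, but `limitSet f` is never empty: shapes with x₁ =
  -- x₂ = r/|r| have `gap` = 2 and belong to it.
  refine tendsto_zero_of_zeros_subset (H := fun p => Metric.infDist p (limitSet f)) hK hsK'
    (G := fun p => (2 - shapeGap p) ^ 2 + ((1 - cosine₁ p ^ 2) * (f ‖p.1‖ - 2 / ‖p.1‖)) ^ 2
      + (cosine₁ p ^ 2 * (1 - cosine₁ p ^ 2)) ^ 2) ?_
    (Metric.continuous_infDist_pt _).continuousOn ?_ ?_
  · exact (((continuousOn_const.sub hcgap).pow 2).add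
      (((continuousOn_const.sub (hca.pow 2)).mul hcf).pow 2)).add
      (((hca.pow 2).mul (continuousOn_const.sub (hca.pow 2))).pow 2)
  · intro p hp hz
    have h1 := sq_nonneg (2 - shapeGap p)
    have h2 := sq_nonneg ((1 - cosine₁ p ^ 2) * (f ‖p.1‖ - 2 / ‖p.1‖))
    have h3 := sq_nonneg (cosine₁ p ^ 2 * (1 - cosine₁ p ^ 2))
    have hz1 : 2 - shapeGap p = 0 := pow_eq_zero_iff two_ne_zero |>.1 (by linarith)
    exact Metric.infDist_zero_of_mem (mem_limitSet (hK0 p hp) (by linarith)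
      (pow_eq_zero_iff two_ne_zero |>.1 (by linarith))
      (pow_eq_zero_iff two_ne_zero |>.1 (by linarith)))
  · simpa using ((hgap.pow 2).add (hforce.pow 2)).add (hdich.pow 2)

end Convergence

/-! ### Circling and rectilinear formations -/

section Circle

/-- The point at arc length `t` on the circle of radius `R` in the plane of `e₁` and `e₂`, divided
by `R`. -/
noncomputable def circ (e₁ e₂ : E3) (R t : ℝ) : E3 :=
  Real.cos (t / R) • e₁ + Real.sin (t / R) • e₂

theorem circ_zero (e₁ e₂ : E3) (R : ℝ) : circ e₁ e₂ R 0 = e₁ := by simp [circ]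

theorem circ_neg (e₁ e₂ : E3) (R t : ℝ) : circ (-e₁) (-e₂) R t = -circ e₁ e₂ R t := by
  simp only [circ, smul_neg]
  abel

/-- Differentiation is a quarter turn (e₁, e₂) ↦ (e₂, -e₁) with a factor 1/R, so tangents and
accelerations are again of the form `circ`. -/
theorem hasDerivAt_circ (e₁ e₂ : E3) (R t : ℝ) :
    HasDerivAt (circ e₁ e₂ R) (R⁻¹ • circ e₂ (-e₁) R t) t := by
  have hd : HasDerivAt (fun t : ℝ => t / R) (1 / R) t := (hasDerivAt_id t).div_const R
  refine ((hd.cos.smul_const e₁).add (hd.sin.smul_const e₂)).congr_deriv ?_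
  simp only [circ, one_div]
  module

variable {e₁ e₂ : E3}

theorem inner_circ_self (h1 : inner ℝ e₁ e₁ = (1 : ℝ)) (h2 : inner ℝ e₂ e₂ = (1 : ℝ))
    (h12 : inner ℝ e₁ e₂ = (0 : ℝ)) (R t : ℝ) :
    inner ℝ (circ e₁ e₂ R t) (circ e₁ e₂ R t) = (1 : ℝ) := by
  simp only [circ, inner_add_left, inner_add_right, real_inner_smul_left, real_inner_smul_right]
  rw [real_inner_comm e₁ e₂, h1, h2, h12]
  linear_combination Real.sin_sq_add_cos_sq (t / R)

theorem inner_circ_tangent (h1 : inner ℝ e₁ e₁ = (1 : ℝ)) (h2 : inner ℝ e₂ e₂ = (1 : ℝ))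
    (h12 : inner ℝ e₁ e₂ = (0 : ℝ)) (R t : ℝ) :
    inner ℝ (circ e₁ e₂ R t) (circ e₂ (-e₁) R t) = (0 : ℝ) := by
  simp only [circ, inner_add_left, inner_add_right, real_inner_smul_left, real_inner_smul_right,
    inner_neg_right]
  rw [real_inner_comm e₁ e₂, h1, h2, h12]
  ring

theorem norm_eq_one_of_inner {v : E3} (hv : inner ℝ v v = (1 : ℝ)) : ‖v‖ = 1 := by
  rw [norm_eq_sqrt_real_inner, hv, Real.sqrt_one]

theorem unitDir_smul {C : E3} (hC : ‖C‖ = 1) {a : ℝ} (ha : 0 < a) : unitDir (a • C) = C := by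
  rw [unitDir, norm_smul, hC, mul_one, Real.norm_of_nonneg ha.le, smul_smul,
    inv_mul_cancel₀ ha.ne', one_smul]

/-- Both headings are orthogonal to the baseline, so the η-term and the reflected part of the μ-term
drop out. -/
theorem steer_circ {C T : E3} (hC : ‖C‖ = 1) (hCT : inner ℝ C T = (0 : ℝ)) {R : ℝ} (hR : 0 < R) :
    steer σ η μ f ((2 * R) • C) T (-T) = (-f (2 * R)) • C + μ (2 * R) • T := by
  have hn : ‖(2 * R) • C‖ = 2 * R := by
    rw [norm_smul, hC, mul_one, Real.norm_of_nonneg (by linarith)]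
  rw [steer, unitDir_smul hC (by linarith), hn, inner_neg_right, hCT]
  simp

/-- The frame carried along a circle. -/
noncomputable def circFrame (e₁ e₂ y z : E3) (R t : ℝ) : E3 × E3 × E3 :=
  (circ e₂ (-e₁) R t, y + (inner ℝ e₁ y : ℝ) • (circ e₁ e₂ R t - e₁),
    z + (inner ℝ e₁ z : ℝ) • (circ e₁ e₂ R t - e₁))

/-- The natural curvatures are constant on the circle, so each normal changes by a fixed multiple of
the displacement. The coefficient m is free, since steering along the heading has no effect. -/
theorem hasDerivAt_circFrame {y z : E3} (h1 : inner ℝ e₁ e₁ = (1 : ℝ))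
    (h12 : inner ℝ e₁ e₂ = (0 : ℝ)) (ho : Orthonormal ℝ ![e₂, y, z]) (R m t : ℝ) :
    HasDerivAt (circFrame e₁ e₂ y z R) (frameField
      ((-R⁻¹) • circ e₁ e₂ R t + m • circ e₂ (-e₁) R t) (circFrame e₁ e₂ y z R t)) t := by
  obtain ⟨h2, -, -, h2y, h2z, -⟩ := inner_of_orthonormal_triple ho
  have hC := hasDerivAt_circ e₁ e₂ R t
  have hT := hasDerivAt_circ e₂ (-e₁) R t
  rw [circ_neg] at hT
  have hw : ∀ v : E3, inner ℝ e₂ v = (0 : ℝ) →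
      inner ℝ ((-R⁻¹) • circ e₁ e₂ R t + m • circ e₂ (-e₁) R t)
        (v + (inner ℝ e₁ v : ℝ) • (circ e₁ e₂ R t - e₁)) = -R⁻¹ * inner ℝ e₁ v := by
    intro v hv
    simp only [circ, inner_add_left, inner_add_right, inner_sub_right, real_inner_smul_left,
      real_inner_smul_right, inner_neg_left, smul_neg]
    rw [real_inner_comm e₁ e₂, h1, h2, h12, hv]
    linear_combination (-R⁻¹ * inner ℝ e₁ v) * Real.sin_sq_add_cos_sq (t / R)
  -- The radial vector e₁ is orthogonal to the heading e₂, hence a combination of y and z.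
  have hsum := sum_inner_smul_of_orthonormal ho e₁
  rw [h12, zero_smul, sub_zero] at hsum
  have hsq : (inner ℝ e₁ y : ℝ) * inner ℝ e₁ y + (inner ℝ e₁ z : ℝ) * inner ℝ e₁ z = 1 := by
    have := congrArg (fun v => (inner ℝ e₁ v : ℝ)) hsum
    simpa only [inner_add_right, real_inner_smul_right, h1] using this
  have hy := ((hC.sub_const e₁).const_smul (inner ℝ e₁ y : ℝ)).const_add y
  have hz := ((hC.sub_const e₁).const_smul (inner ℝ e₁ z : ℝ)).const_add z
  refine (hT.prodMk (hy.prodMk hz)).congr_deriv ?_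
  simp only [frameField, circFrame]
  rw [hw y h2y, hw z h2z]
  refine Prod.ext ?_ (Prod.ext ?_ ?_)
  · change R⁻¹ • -circ e₁ e₂ R t = _
    have h3 : (-R⁻¹ * inner ℝ e₁ y) • (y + (inner ℝ e₁ y : ℝ) • (circ e₁ e₂ R t - e₁)) +
        (-R⁻¹ * inner ℝ e₁ z) • (z + (inner ℝ e₁ z : ℝ) • (circ e₁ e₂ R t - e₁)) =
        (-R⁻¹) • (((inner ℝ e₁ y : ℝ) • y + (inner ℝ e₁ z : ℝ) • z)
          + ((inner ℝ e₁ y : ℝ) * inner ℝ e₁ y + (inner ℝ e₁ z : ℝ) * inner ℝ e₁ z) •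
            (circ e₁ e₂ R t - e₁)) := by module
    rw [h3, hsum, hsq]
    module
  · change (inner ℝ e₁ y : ℝ) • R⁻¹ • circ e₂ (-e₁) R t = _
    module
  · change (inner ℝ e₁ z : ℝ) • R⁻¹ • circ e₂ (-e₁) R t = _
    module

end Circle

/-- A trajectory over `Λ'` whose state agrees initially with another solution of the closed-loop
equations has the same state for all time. -/
theorem state_eq_of_field (H : GainConditions σ f h μ η) {s : ℝ → Pair}
    (hs : IsTrajectoryOn σ η μ f (Ici 0) s) (h0 : (s 0).shape ∈ Lam) {y : ℝ → State}
    (hy : ∀ t, HasDerivAt y (field σ η μ f (y t)) t) (hyr : ∀ t, (y t).1 ≠ 0)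
    (hy0 : (s 0).state = y 0) : ∀ t, 0 ≤ t → (s t).state = y t := by
  intro t ht
  have hs' : IsTrajectoryOn σ η μ f (Icc 0 t) s := hs.mono Icc_subset_Ici_self
  exact eqOn_of_locallyLipschitzOn (locallyLipschitzOn_field σ H.lip_η H.lip_μ H.lip_f)
    (isTrajectoryOn_iff.1 hs').2.2 (fun τ _ => (hy τ).hasDerivWithinAt)
    (fun τ hτ => (mem_Lam_iff.1 (hs'.mem_Lam H h0 τ hτ)).1) (fun τ _ => hyr τ) hy0 ⟨ht, le_rfl⟩

/-- The position of a vehicle is determined by its heading. -/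
theorem pos_eq_of_heading {p : ℝ → E3} {P x : ℝ → E3}
    (hp : ∀ t ∈ Ici (0 : ℝ), HasDerivWithinAt p (x t) (Ici 0) t)
    (hP : ∀ t, 0 ≤ t → HasDerivAt P (x t) t) (h0 : p 0 = P 0) : ∀ t, 0 ≤ t → p t = P t := by
  intro t ht
  have := eq_of_hasDerivWithinAt_zero (τ := t) (y := fun τ => p τ - P τ) (fun τ hτ => by
    have := ((hp τ hτ.1).mono (show Icc 0 t ⊆ Ici 0 from Icc_subset_Ici_self)).sub (hP τ hτ.1).hasDerivWithinAt
    rwa [sub_self] at this) t ⟨ht, le_rfl⟩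
  rw [h0, sub_self] at this
  exact sub_eq_zero.1 this

theorem followsCommonCircle_of_mem (H : GainConditions σ f h μ η) {s : ℝ → Pair}
    (hs : IsTrajectoryOn σ η μ f (Ici 0) s) (h0 : (s 0).shape ∈ circlingSet f ∩ Lam) :
    FollowsCommonCircle s := by
  obtain ⟨⟨hx, hrx, hf⟩, hL⟩ := h0
  change (s 0).v1.x = -(s 0).v2.x at hx
  change inner ℝ (s 0).rel (s 0).v1.x = (0 : ℝ) at hrx
  change f ‖(s 0).rel‖ = 2 / ‖(s 0).rel‖ at hf
  have hr := (mem_Lam_iff.1 hL).1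
  have hn := norm_pos_iff.2 hr
  -- The baseline is a diameter; f = 2/|r| then reads f(2R) = 1/R, the curvature of the circle.
  obtain ⟨R, hRdef⟩ : ∃ R : ℝ, ‖(s 0).rel‖ = 2 * R := ⟨‖(s 0).rel‖ / 2, by ring⟩
  have hR : 0 < R := by linarith
  have hfR : f (2 * R) = R⁻¹ := by
    rw [← hRdef, hf, hRdef]
    field_simp
  -- The sign makes e₁ point from the centre to the first vehicle, as r points from the first to the
  -- second.
  obtain ⟨e₁, he₁⟩ : ∃ e₁ : E3, e₁ = -unitDir (s 0).rel := ⟨_, rfl⟩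
  obtain ⟨e₂, he₂⟩ : ∃ e₂ : E3, e₂ = (s 0).v1.x := ⟨_, rfl⟩
  have hrel : (s 0).rel = -((2 * R) • e₁) := by
    rw [he₁, smul_neg, neg_neg, ← hRdef, norm_smul_unitDir hr]
  have h1 : inner ℝ e₁ e₁ = (1 : ℝ) := by rw [he₁, inner_neg_neg, inner_unitDir_self hr]
  have h12 : inner ℝ e₁ e₂ = (0 : ℝ) := by
    rw [he₁, he₂, inner_neg_left, unitDir, real_inner_smul_left, hrx, mul_zero, neg_zero]
  have ho1 : Orthonormal ℝ ![e₂, (s 0).v1.y, (s 0).v1.z] := he₂ ▸ (s 0).v1.orthonormal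
  have hx2 : (s 0).v2.x = -e₂ := by rw [he₂, hx, neg_neg]
  have ho2 : Orthonormal ℝ ![-e₂, (s 0).v2.y, (s 0).v2.z] := hx2 ▸ (s 0).v2.orthonormal
  have h2 : inner ℝ e₂ e₂ = (1 : ℝ) := (inner_of_orthonormal_triple ho1).1
  have h1' : inner ℝ (-e₁) (-e₁) = (1 : ℝ) := by rw [inner_neg_neg, h1]
  have h12' : inner ℝ (-e₁) (-e₂) = (0 : ℝ) := by rw [inner_neg_neg, h12]
  have hC := fun t => norm_eq_one_of_inner (inner_circ_self h1 h2 h12 R t)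
  have hCT := fun t => inner_circ_tangent h1 h2 h12 R t
  let y : ℝ → State := fun t => (-((2 * R) • circ e₁ e₂ R t),
    circFrame e₁ e₂ (s 0).v1.y (s 0).v1.z R t,
    circFrame (-e₁) (-e₂) (s 0).v2.y (s 0).v2.z R t)
  have hT2 : ∀ t, circ (-e₂) (- -e₁) R t = -circ e₂ (-e₁) R t := fun t => circ_neg _ _ _ _
  have hy : ∀ t, HasDerivAt y (field σ η μ f (y t)) t := by
    intro t
    have hd1 := hasDerivAt_circFrame h1 h12 ho1 R (μ (2 * R)) t
    have hd2 := hasDerivAt_circFrame h1' h12' ho2 R (μ (2 * R)) t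
    have hdr := ((hasDerivAt_circ e₁ e₂ R t).const_smul (2 * R)).neg
    refine (hdr.prodMk (hd1.prodMk hd2)).congr_deriv ?_
    have hw1 : steer σ η μ f (-(y t).1) (y t).2.1.1 (y t).2.2.1 =
        (-R⁻¹) • circ e₁ e₂ R t + μ (2 * R) • circ e₂ (-e₁) R t := by
      change steer σ η μ f (- -((2 * R) • circ e₁ e₂ R t)) (circ e₂ (-e₁) R t)
        (circ (-e₂) (- -e₁) R t) = _
      rw [neg_neg, hT2, steer_circ (hC t) (hCT t) hR, hfR]
    have hw2 : steer σ η μ f (y t).1 (y t).2.2.1 (y t).2.1.1 =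
        (-R⁻¹) • circ (-e₁) (-e₂) R t + μ (2 * R) • circ (-e₂) (- -e₁) R t := by
      change steer σ η μ f (-((2 * R) • circ e₁ e₂ R t)) (circ (-e₂) (- -e₁) R t)
        (circ e₂ (-e₁) R t) = _
      have := steer_circ (σ := σ) (η := η) (μ := μ) (f := f) (C := -circ e₁ e₂ R t)
        (T := -circ e₂ (-e₁) R t) (by rw [norm_neg, hC t])
        (by rw [inner_neg_neg, hCT t]) hR
      rw [neg_neg, smul_neg, hfR] at this
      rw [hT2, this, circ_neg]
    rw [field, hw1, hw2]
    refine Prod.ext ?_ rfl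
    change -((2 * R) • R⁻¹ • circ e₂ (-e₁) R t) = circ (-e₂) (- -e₁) R t - circ e₂ (-e₁) R t
    rw [hT2, smul_smul, mul_assoc, mul_inv_cancel₀ hR.ne']
    module
  have hst := state_eq_of_field H hs hL hy (fun t => by
    change -((2 * R) • circ e₁ e₂ R t) ≠ 0
    rw [neg_ne_zero, ← norm_ne_zero_iff, norm_smul, hC t, mul_one, norm_ne_zero_iff]
    linarith) (by
    simp only [y, circFrame, circ_zero, sub_self, smul_zero, add_zero, Pair.state, Vehicle.frame,
      hrel, he₂, hx, neg_neg])
  have hx1 : ∀ t, 0 ≤ t → (s t).v1.x = circ e₂ (-e₁) R t := fun t ht =>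
    congrArg (fun q : State => q.2.1.1) (hst t ht)
  have hpos := pos_eq_of_heading (isTrajectoryOn_iff.1 hs).1
    (P := fun t => ((s 0).v1.pos - R • e₁) + R • circ e₁ e₂ R t) (fun t ht => by
      rw [hx1 t ht]
      refine (((hasDerivAt_circ e₁ e₂ R t).const_smul R).const_add _).congr_deriv ?_
      rw [smul_smul, mul_inv_cancel₀ hR.ne', one_smul])
    (by simp only [circ_zero, sub_add_cancel])
  have hrelt : ∀ t, 0 ≤ t → (s t).v2.pos - (s t).v1.pos = -((2 * R) • circ e₁ e₂ R t) :=
    fun t ht => congrArg (fun q : State => q.1) (hst t ht)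
  have hon : Orthonormal ℝ ![e₁, e₂] := by
    constructor
    · intro i
      fin_cases i
      · exact norm_eq_one_of_inner h1
      · exact norm_eq_one_of_inner h2
    · intro i j hij
      fin_cases i <;> fin_cases j <;> first | exact absurd rfl hij | skip
      · exact h12
      · exact (real_inner_comm _ _).trans h12
  refine ⟨(s 0).v1.pos - R • e₁, e₁, e₂, R, hR, hon, fun t ht => ⟨hpos t ht, ?_⟩⟩
  rw [eq_add_of_sub_eq (hrelt t ht), hpos t ht]
  change _ = _ - R • circ e₁ e₂ R t
  module

theorem HasDerivWithinAt.unique_Ici {p : ℝ → E3} {v w : E3} {t : ℝ} (ht : 0 ≤ t)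
    (hv : HasDerivWithinAt p v (Ici 0) t) (hw : HasDerivWithinAt p w (Ici 0) t) : v = w :=
  (uniqueDiffOn_Ici (0 : ℝ) t ht).eq_deriv _ hv hw

/-- Velocities fix the headings. Comparing the acceleration at time 0 with the control law and
projecting on e₁ gives f(2R) = 1/R. -/
theorem mem_of_followsCommonCircle {s : ℝ → Pair}
    (hs : IsTrajectoryOn σ η μ f (Ici 0) s) (hc : FollowsCommonCircle s) :
    (s 0).shape ∈ circlingSet f ∩ Lam := by
  obtain ⟨c, e₁, e₂, R, hR, hon, hpos⟩ := hc
  have h1 : inner ℝ e₁ e₁ = (1 : ℝ) := by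
    have : ‖e₁‖ = 1 := hon.1 0
    rw [real_inner_self_eq_norm_sq, this, one_pow]
  have h2 : inner ℝ e₂ e₂ = (1 : ℝ) := by
    have : ‖e₂‖ = 1 := hon.1 1
    rw [real_inner_self_eq_norm_sq, this, one_pow]
  have h12 : inner ℝ e₁ e₂ = (0 : ℝ) := hon.2 (show (0 : Fin 2) ≠ 1 by decide)
  have hp := (isTrajectoryOn_iff.1 hs)
  have hd : ∀ t, HasDerivAt (fun t => R • circ e₁ e₂ R t) (circ e₂ (-e₁) R t) t := fun t => by
    refine ((hasDerivAt_circ e₁ e₂ R t).const_smul R).congr_deriv ?_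
    rw [smul_smul, mul_inv_cancel₀ hR.ne', one_smul]
  have hx1 : ∀ t, 0 ≤ t → (s t).v1.x = circ e₂ (-e₁) R t := fun t ht =>
    HasDerivWithinAt.unique_Ici ht (hp.1 t ht)
      (((hd t).const_add c).hasDerivWithinAt.congr (fun τ hτ => (hpos τ hτ).1) (hpos t ht).1)
  have hx2 : ∀ t, 0 ≤ t → (s t).v2.x = -circ e₂ (-e₁) R t := fun t ht =>
    HasDerivWithinAt.unique_Ici ht (hp.2.1 t ht)
      (((hd t).const_sub c).hasDerivWithinAt.congr (fun τ hτ => (hpos τ hτ).2) (hpos t ht).2)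
  have hx10 : (s 0).v1.x = e₂ := by rw [hx1 0 le_rfl, circ_zero]
  have hx20 : (s 0).v2.x = -e₂ := by rw [hx2 0 le_rfl, circ_zero]
  have hrel : (s 0).rel = -((2 * R) • e₁) := by
    have ha := (hpos 0 le_rfl).1
    have hb := (hpos 0 le_rfl).2
    rw [← circ, circ_zero] at ha hb
    rw [Pair.rel, ha, hb]
    module
  have hn : ‖(s 0).rel‖ = 2 * R := by
    rw [hrel, norm_neg, norm_smul, norm_eq_one_of_inner h1, mul_one,
      Real.norm_of_nonneg (by linarith)]
  have hacc := hs.isReducedOn.head₁ 0 (mem_Ici.2 le_rfl)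
  have hacc' := ((hasDerivAt_circ e₂ (-e₁) R 0).hasDerivWithinAt (s := Ici 0)).congr
    (fun τ hτ => hx1 τ hτ) (hx1 0 le_rfl)
  have heq := HasDerivWithinAt.unique_Ici le_rfl hacc hacc'
  rw [hrel, neg_neg, hx10, hx20, steer_circ (norm_eq_one_of_inner h1) h12 hR, circ_zero] at heq
  have hin := congrArg (fun v => (inner ℝ e₁ v : ℝ)) heq
  simp only [inner_sub_right, inner_add_right, real_inner_smul_right, inner_neg_right, h1, h12]
    at hin
  have hf : f (2 * R) = R⁻¹ := by linarith
  have hr : (s 0).rel ≠ 0 := norm_ne_zero_iff.1 (by rw [hn]; linarith)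
  refine ⟨⟨?_, ?_, ?_⟩, mem_Lam_iff.2 ⟨hr, ?_⟩⟩
  · change (s 0).v1.x = -(s 0).v2.x
    rw [hx10, hx20, neg_neg]
  · change inner ℝ (s 0).rel (s 0).v1.x = (0 : ℝ)
    rw [hrel, hx10, inner_neg_left, real_inner_smul_left, h12, mul_zero, neg_zero]
  · change f ‖(s 0).rel‖ = 2 / ‖(s 0).rel‖
    rw [hn, hf]
    field_simp
  · have hu : unitDir (s 0).rel = -e₁ := by
      rw [hrel, unitDir_neg, unitDir_smul (norm_eq_one_of_inner h1) (by linarith)]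
    rw [gap, hu, hx10, hx20]
    simp only [inner_neg_left, inner_neg_right, h2, h12]
    norm_num

/-- Each steering vector is parallel to its heading and the headings agree, so the closed-loop field
vanishes at the initial state. By uniqueness the relative position and frames never change. -/
theorem followsCommonLine_of_mem (H : GainConditions σ f h μ η) {s : ℝ → Pair}
    (hs : IsTrajectoryOn σ η μ f (Ici 0) s) (h0 : (s 0).shape ∈ rectilinearSet ∩ Lam) :
    FollowsCommonLine s := by
  obtain ⟨⟨hx, hxu⟩, hL⟩ := h0
  change (s 0).v1.x = (s 0).v2.x at hx
  change (s 0).v1.x = unitDir (s 0).rel ∨ (s 0).v1.x = -unitDir (s 0).rel at hxu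
  have hr := (mem_Lam_iff.1 hL).1
  have hn := norm_pos_iff.2 hr
  -- Here ε = ±1 records whether the second vehicle is ahead or behind, so |r|ε is the signed
  -- separation.
  obtain ⟨ε, hε, hu⟩ : ∃ ε : ℝ, ε ≠ 0 ∧ unitDir (s 0).rel = ε • (s 0).v1.x := by
    rcases hxu with h | h
    · exact ⟨1, one_ne_zero, by rw [h, one_smul]⟩
    · exact ⟨-1, by norm_num, by rw [h, neg_one_smul, neg_neg]⟩
  have hrel : (s 0).rel = (‖(s 0).rel‖ * ε) • (s 0).v1.x := by
    rw [← smul_smul, ← hu, norm_smul_unitDir hr]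
  obtain ⟨-, -, -, hy1, hz1, -⟩ := inner_of_orthonormal_triple (s 0).v1.orthonormal
  obtain ⟨-, -, -, hy2, hz2, -⟩ := inner_of_orthonormal_triple (s 0).v2.orthonormal
  have hzero : field σ η μ f (s 0).state = 0 := by
    have hF : ∀ (k : ℝ) (F : E3 × E3 × E3), inner ℝ F.1 F.2.1 = (0 : ℝ) →
        inner ℝ F.1 F.2.2 = (0 : ℝ) → frameField (k • F.1) F = 0 := by
      intro k F h1 h2
      simp only [frameField, real_inner_smul_left, h1, h2, mul_zero, zero_smul, neg_zero, add_zero]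
      rfl
    have hw1 : ∃ k : ℝ, steer σ η μ f (-(s 0).rel) (s 0).v1.x (s 0).v2.x = k • (s 0).v1.x := by
      rw [steer, unitDir_neg, hu, ← hx]
      exact ⟨_, by rw [← neg_smul, smul_smul, ← sub_smul]⟩
    have hw2 : ∃ k : ℝ, steer σ η μ f (s 0).rel (s 0).v2.x (s 0).v1.x = k • (s 0).v2.x := by
      rw [steer, hu, ← hx]
      exact ⟨_, by rw [smul_smul, ← sub_smul]⟩
    obtain ⟨k₁, hk₁⟩ := hw1
    obtain ⟨k₂, hk₂⟩ := hw2
    refine Prod.ext ?_ (Prod.ext ?_ ?_)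
    · change (s 0).v2.x - (s 0).v1.x = 0
      rw [hx, sub_self]
    · change frameField (steer σ η μ f (-(s 0).rel) (s 0).v1.x (s 0).v2.x) (s 0).v1.frame = 0
      rw [hk₁]
      exact hF k₁ _ hy1 hz1
    · change frameField (steer σ η μ f (s 0).rel (s 0).v2.x (s 0).v1.x) (s 0).v2.frame = 0
      rw [hk₂]
      exact hF k₂ _ hy2 hz2
  have hst := state_eq_of_field H hs hL (y := fun _ => (s 0).state)
    (fun t => by rw [hzero]; exact hasDerivAt_const _ _) (fun _ => hr) rfl
  have hpos := pos_eq_of_heading (isTrajectoryOn_iff.1 hs).1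
    (P := fun t => (s 0).v1.pos + t • (s 0).v1.x) (fun t ht => by
      have : (s t).v1.x = (s 0).v1.x := congrArg (fun q : State => q.2.1.1) (hst t ht)
      rw [this]
      simpa using ((hasDerivAt_id t).smul_const (s 0).v1.x).const_add (s 0).v1.pos)
    (by simp)
  refine ⟨(s 0).v1.pos, (s 0).v1.x, ‖(s 0).rel‖ * ε, (s 0).v1.orthonormal.1 0,
    mul_ne_zero hn.ne' hε, fun t ht => ⟨hpos t ht, ?_⟩⟩
  have hrelt : (s t).v2.pos - (s t).v1.pos = (s 0).rel :=
    congrArg (fun q : State => q.1) (hst t ht)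
  rw [eq_add_of_sub_eq hrelt, hpos t ht, add_smul, ← hrel]
  abel

theorem mem_of_followsCommonLine {s : ℝ → Pair}
    (hs : IsTrajectoryOn σ η μ f (Ici 0) s) (hc : FollowsCommonLine s) :
    (s 0).shape ∈ rectilinearSet ∩ Lam := by
  obtain ⟨c, e, d, he, hd, hpos⟩ := hc
  have hp := isTrajectoryOn_iff.1 hs
  have hx1 : (s 0).v1.x = e := by
    refine HasDerivWithinAt.unique_Ici le_rfl (hp.1 0 (mem_Ici.2 le_rfl)) ?_
    have : HasDerivAt (fun t : ℝ => c + t • e) e 0 := by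
      simpa using ((hasDerivAt_id (0 : ℝ)).smul_const e).const_add c
    exact this.hasDerivWithinAt.congr (fun τ hτ => (hpos τ hτ).1) (hpos 0 le_rfl).1
  have hx2 : (s 0).v2.x = e := by
    refine HasDerivWithinAt.unique_Ici le_rfl (hp.2.1 0 (mem_Ici.2 le_rfl)) ?_
    have : HasDerivAt (fun t : ℝ => c + (t + d) • e) e 0 := by
      simpa using (((hasDerivAt_id (0 : ℝ)).add_const d).smul_const e).const_add c
    exact this.hasDerivWithinAt.congr (fun τ hτ => (hpos τ hτ).2) (hpos 0 le_rfl).2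
  have hrel : (s 0).rel = d • e := by
    rw [Pair.rel, (hpos 0 le_rfl).1, (hpos 0 le_rfl).2]
    module
  have hee : inner ℝ e e = (1 : ℝ) := by rw [real_inner_self_eq_norm_sq, he, one_pow]
  have hu : e = unitDir (s 0).rel ∨ e = -unitDir (s 0).rel := by
    rcases lt_or_gt_of_ne hd with h | h
    · right
      rw [← unitDir_neg, hrel, ← neg_smul, unitDir_smul he (neg_pos.2 h)]
    · left
      rw [hrel, unitDir_smul he h]
  have hr : (s 0).rel ≠ 0 := by
    rw [hrel, ← norm_ne_zero_iff, norm_smul, he, mul_one]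
    exact norm_ne_zero_iff.2 hd
  refine ⟨⟨hx1.trans hx2.symm, ?_⟩, mem_Lam_iff.2 ⟨hr, ?_⟩⟩
  · change (s 0).v1.x = _ ∨ (s 0).v1.x = _
    rw [hx1]
    exact hu
  · rw [gap, hx1, hx2]
    rcases hu with h | h
    · rw [← h, hee]; norm_num
    · rw [show unitDir (s 0).rel = -e by rw [h, neg_neg], inner_neg_left, hee]; norm_num

end TwoVehicle

theorem proposition5
    (f h μ η : ℝ → ℝ) (σ : ℝ) (hσ : σ = 1 ∨ σ = -1)
    -- the potential `h` and the function `f`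
    (hh : ∀ ρ, 0 < ρ → HasDerivAt h (f ρ - 2 / ρ) ρ)
    (hf : LocallyLipschitzOn (Ioi 0) f)
    -- `h` is unbounded at both ends and has a zero
    (h_zero : Tendsto h (𝓝[>] 0) atTop)
    (h_top : Tendsto h atTop atTop)
    (h_root : ∃ ρ, 0 < ρ ∧ h ρ = 0)
    -- regularity of the gains
    (hμ : LocallyLipschitzOn (Ioi 0) μ)
    (hη : LocallyLipschitzOn (Ioi 0) η)
    -- size of the gains
    (hμη : ∀ ρ, 0 < ρ → η ρ / 2 < μ ρ ∧ 0 < η ρ / 2) :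
    -- a trajectory defined for all future time starts at every state over `Λ'`
    (∀ s₀ : Pair, s₀.shape ∈ Lam →
      ∃ s : ℝ → Pair, IsTrajectoryOn σ η μ f (Ici 0) s ∧ s 0 = s₀) ∧
    -- every trajectory starting over `Λ'` extends to all future time
    (∀ (T : ℝ) (s : ℝ → Pair), 0 < T → IsTrajectoryOn σ η μ f (Ico 0 T) s →
      (s 0).shape ∈ Lam →
      ∃ s' : ℝ → Pair, IsTrajectoryOn σ η μ f (Ici 0) s' ∧ ∀ t ∈ Ico 0 T, s' t = s t) ∧
    -- every trajectory starting over `Λ'` stays there and converges to `M̃'`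
    (∀ s : ℝ → Pair, IsTrajectoryOn σ η μ f (Ici 0) s → (s 0).shape ∈ Lam →
      (∀ t, 0 ≤ t → (s t).shape ∈ Lam) ∧
      Tendsto (fun t => Metric.infDist (s t).shape (limitSet f)) atTop (𝓝 0)) ∧
    -- the two kinds of formation that make up `M̃'`
    (∀ s : ℝ → Pair, IsTrajectoryOn σ η μ f (Ici 0) s →
      ((s 0).shape ∈ circlingSet f ∩ Lam ↔ FollowsCommonCircle s) ∧
      ((s 0).shape ∈ rectilinearSet ∩ Lam ↔ FollowsCommonLine s)) := by
  have H : GainConditions σ f h μ η := ⟨hσ, hh, hf, h_zero, h_top, hμ, hη, hμη⟩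
  refine ⟨fun s₀ h₀ => exists_trajectory H h₀, fun T s _ hs h₀ => exists_extension H hs h₀,
    fun s hs h₀ => ⟨fun t ht => ?_, tendsto_infDist_limitSet H hs h₀⟩,
    fun s hs => ⟨⟨followsCommonCircle_of_mem H hs, mem_of_followsCommonCircle hs⟩,
      ⟨followsCommonLine_of_mem H hs, mem_of_followsCommonLine hs⟩⟩⟩
  exact (hs.mono (show Icc 0 t ⊆ Ici 0 from Icc_subset_Ici_self)).mem_Lam H h₀ t ⟨ht, le_rfl⟩
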